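/- **Definitions.** All graphs are finite and simple. A $B_1$-ENPG graph is a graph $G$ for which there are simple paths $P_v$ $(v\in V(G))$ in the square grid, not necessarily distinct and each with at most one bend, such that distinct vertices $u,v$ are adjacent if and only if $P_u,P_v$ have a common edge and no vertex has degree at least $3$ in $P_u\cup P_v$. Two adjacent (resp. distinct non-adjacent) vertices $u,v$ are twins (resp. false twins) if $N(u)\setminus\{v\}=N(v)\setminus\{u\}$. We write $G=S(K,S,E)$ for a connected graph whose vertex set is partitioned into a clique $K$ and a stable set $S$ such that no vertex of $S$ is adjacent to all of $K$. For $T\subseteq S$, $T_d$ is the set of vertices of $T$ of degree $d$ in $G$; in particular $S_{X,Y,d}=(S_{X,Y})_d$, and similarly for the other classes below. For $X\in\{L,R\}$ let $\bar X$ be the other element of $\{L,R\}$. A *certificate* for $G=S(K,S,E)$ consists of two partitions $\{K_{L,H},K_{L,V}\}$, $\{K_{R,H},K_{R,V}\}$ of $K$ with $K_{L,V}\cap K_{R,V}=\emptyset$, a permutation $\sigma_{X,Y}$ of each $K_{X,Y}$ ($Y\in\{H,V\}$), a partition of $S$ into classes $S_{X,H},S_{X,V},S_{X,HH},S_{X,HV}$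 ($X\in\{L,R\}$; parts may be empty), and for each $s\in S$ a sequence $\sigma_s$, such that for all $X,Y$: 1. if $s\in S_{X,Y}$, then $N(s)$ is (the set of elements of) an interval $\sigma_s$ of $\sigma_{X,Y}$; 2. if $s\in S_{X,HH}$, then $N(s)=\sigma_s\cap K_{\bar X,H}$ for a prefix $\sigma_s$ of $\sigma_{X,H}$; 3. if $s\in S_{X,HV}$, then $N(s)=\sigma_s\cup K_{X,V}$ for a nonempty suffix $\sigma_s$ of $\sigma_{X,H}$; 4. if $s\in S_{X,H}\cup S_{X,HH}$, then there is at most one $s'\in S_{X,HV}$ such that $\sigma_s$ and $\sigma_{s'}$ overlap (intersect, with neither containing the other); 5. if $S_{X,HH}\neq\emptyset$, then $|S_{\bar X,HV}|\le 1$; 6. $K_{X,V}\subseteq K_{\bar X,H}$. **Proposition.** Let $G=S(K,S,E)$ be a $B_1$-ENPG graph without twins and without false twins. Then for every certificate, all $X\in\{L,R\}$, $Y\in\{H,V\}$ and every integer $d\ge 0$: $$|S_{X,Y,d}|\le\max\{|K_{X,Y}|+1-d,\,0\},$$ $$|S_{X,HV,d}|\le\begin{cases}1&\text{if }d>|K_{X,V}|\\0&\text{otherwise,}\end{cases}$$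 $$|S_{X,V,d}\cup S_{X,HV,d}|\le\begin{cases}1&\text{if }d>|K_{X,V}|\\|K_{X,V}|+1-d&\text{otherwise,}\end{cases}$$ $$|S_{X,HH,d}|\le\begin{cases}1&\text{if }d\le|K_{L,H}\cap K_{R,H}|\\0&\text{otherwise}\end{cases}\ \le 1.$$ Moreover, for every integer $d\ge0$, $$|S_d|\le\max\{2(|K|+2-d),\,0\}.$$ **Corollary.** There is an absolute constant $c$ such that $|S|\le c\,|K|^2$ for every $B_1$-ENPG graph $G=S(K,S,E)$ without false twins. -/

import Mathlib

universe u

namespace BendENPG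

/-! ### Paths in the grid and edge-intersecting non-splitting graphs -/

/-- The (square) grid on the integer points of the plane. A finite family of paths always lies in a
finite rectangular part of it. -/
def grid : SimpleGraph (ℤ × ℤ) where
  Adj p q := (p.1 = q.1 ∧ |p.2 - q.2| = 1) ∨ (p.2 = q.2 ∧ |p.1 - q.1| = 1)
  symm := ⟨by
    intro p q h
    rcases h with ⟨h1, h2⟩ | ⟨h1, h2⟩
    · exact Or.inl ⟨h1.symm, by rw [abs_sub_comm]; exact h2⟩
    · exact Or.inr ⟨h1.symm, by rw [abs_sub_comm]; exact h2⟩⟩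
  loopless := ⟨by
    intro p h
    rcases h with ⟨_, h2⟩ | ⟨_, h2⟩ <;> simp at h2⟩

/-- A simple path of the grid. -/
structure GridPath where
  src : ℤ × ℤ
  tgt : ℤ × ℤ
  walk : grid.Walk src tgt
  isPath : walk.IsPath

namespace GridPath

/-- The vertices and edges of a path, as a subgraph of the grid. -/
def graph (P : GridPath) : grid.Subgraph := P.walk.toSubgraph

/-- The bends of a path: the vertices incident, in the path, to a horizontal and to a vertical
edge. -/
def bends (P : GridPath) : Set (ℤ × ℤ) :=
  {x | ∃ a b, P.graph.Adj x a ∧ P.graph.Adj x b ∧ a.2 = x.2 ∧ b.1 = x.1}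

/-- The splits of two paths: the vertices of degree at least `3` in the union of the paths. -/
def splits (P Q : GridPath) : Set (ℤ × ℤ) :=
  {x | 3 ≤ ((P.graph ⊔ Q.graph).neighborSet x).encard}

/-- `P ∼ Q`: the two paths have a common edge and no split. -/
def NonSplitting (P Q : GridPath) : Prop :=
  (P.graph.edgeSet ∩ Q.graph.edgeSet).Nonempty ∧ splits P Q = ∅

end GridPath

/-- `G` is `B_k`-ENPG: its vertices can be represented by (not necessarily distinct) grid paths with
at most `k` bends each, such that two distinct vertices are adjacent if and only if their paths have
a common edge and do not split. -/
def IsBendENPG {V : Type u} (k : ℕ) (G : SimpleGraph V) : Prop :=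
  ∃ P : V → GridPath, (∀ v, (P v).bends.encard ≤ k) ∧
    ∀ u v, G.Adj u v ↔ u ≠ v ∧ (P u).NonSplitting (P v)

/-! ### Twins and split graphs -/

/-- No two adjacent vertices are twins. -/
def TwinFree {V : Type u} (G : SimpleGraph V) : Prop :=
  ∀ u v, G.Adj u v → G.neighborSet u \ {v} ≠ G.neighborSet v \ {u}

/-- No two distinct non-adjacent vertices are false twins. -/
def FalseTwinFree {V : Type u} (G : SimpleGraph V) : Prop :=
  ∀ u v, u ≠ v → ¬ G.Adj u v → G.neighborSet u \ {v} ≠ G.neighborSet v \ {u}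

/-- `G` is a connected split graph `S(K, S, E)`: the vertex set is partitioned into the clique `K`
and the stable set `S`, and no vertex of `S` is adjacent to all vertices of `K`. -/
structure IsSplit {V : Type u} [Fintype V] [DecidableEq V] (G : SimpleGraph V) (K S : Finset V) :
    Prop where
  connected : G.Connected
  disjoint : Disjoint K S
  union_eq : K ∪ S = Finset.univ
  clique : G.IsClique (K : Set V)
  stable : G.IsIndepSet (S : Set V)
  maximal : ∀ s ∈ S, ∃ v ∈ K, ¬ G.Adj s v

/-- The vertices of `T` of degree `d` in `G`. -/
def ofDegree {V : Type u} [Fintype V] (G : SimpleGraph V) [DecidableRel G.Adj]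
    (T : Finset V) (d : ℕ) : Finset V :=
  T.filter fun v => G.degree v = d

/-! ### The partitions and permutations of the characterization -/

/-- The index `X ∈ {L, R}`. -/
inductive Side
  | L
  | R

/-- The other side. -/
def Side.bar : Side → Side
  | .L => .R
  | .R => .L

/-- The index `Y ∈ {H, V}`. -/
inductive Dir
  | H
  | V

/-- The second index of a class of the partition of `S`: `H`, `V`, `HH` or `HV`. -/
inductive Kind
  | dir (Y : Dir)
  | HH
  | HV

/-- Two sequences overlap: they have a common element, and neither contains the other. -/
def Overlap {V : Type u} (a b : List V) : Prop :=
  (∃ v, v ∈ a ∧ v ∈ b) ∧ ¬ a ⊆ b ∧ ¬ b ⊆ a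

/-- The partitions `{K_{X,H}, K_{X,V}}` of `K`, the permutations `σ_{X,Y}` of `K_{X,Y}`, the
partition of `S` into the classes `S_{X,H}, S_{X,V}, S_{X,HH}, S_{X,HV}`, and the intervals
(prefixes, suffixes) `σ_s`, which together certify the structure of a one-bend ENPG split graph.
Parts may be empty. The suffix of a vertex of `S_{X,HV}` is nonempty; for the other classes, `σ_s` is
nonempty as soon as `s` is not isolated. -/
structure Certificate {V : Type u} [DecidableEq V] (G : SimpleGraph V) (K S : Finset V) where
  KPart : Side → Dir → Finset V
  perm : Side → Dir → List V
  SPart : Side → Kind → Finset V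
  arc : V → List V
  KPart_union : ∀ X, KPart X .H ∪ KPart X .V = K
  KPart_disjoint : ∀ X, Disjoint (KPart X .H) (KPart X .V)
  vertical_disjoint : Disjoint (KPart .L .V) (KPart .R .V)
  perm_nodup : ∀ X Y, (perm X Y).Nodup
  perm_toFinset : ∀ X Y, (perm X Y).toFinset = KPart X Y
  SPart_cover : ∀ s, s ∈ S ↔ ∃ X Z, s ∈ SPart X Z
  SPart_disjoint : ∀ X Z X' Z', (X, Z) ≠ (X', Z') → Disjoint (SPart X Z) (SPart X' Z')
  interval : ∀ X Y, ∀ s ∈ SPart X (.dir Y),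
    arc s <:+: perm X Y ∧ ∀ v, G.Adj s v ↔ v ∈ arc s
  prefix_inter : ∀ X, ∀ s ∈ SPart X .HH,
    arc s <+: perm X .H ∧ ∀ v, G.Adj s v ↔ v ∈ arc s ∧ v ∈ KPart X.bar .H
  suffix_union : ∀ X, ∀ s ∈ SPart X .HV,
    arc s ≠ [] ∧ arc s <:+ perm X .H ∧ ∀ v, G.Adj s v ↔ v ∈ arc s ∨ v ∈ KPart X .V
  overlap_unique : ∀ X, ∀ s ∈ SPart X (.dir .H) ∪ SPart X .HH,
    ∀ s₁ ∈ SPart X .HV, ∀ s₂ ∈ SPart X .HV,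
      Overlap (arc s) (arc s₁) → Overlap (arc s) (arc s₂) → s₁ = s₂
  suffix_unique : ∀ X, (SPart X .HH).Nonempty → (SPart X.bar .HV).card ≤ 1
  vertical_subset : ∀ X, KPart X .V ⊆ KPart X.bar .H

end BendENPG

/-! Without false twins a vertex of `S` is determined by its neighbourhood, so everything reduces to
counting sets of one size `d`. Intervals of size `d` in a linear order on `m` elements are
determined by their starting point, which gives at most `m + 1 - d`; sets of size `d` that form a
chain coincide. In a certificate the classes `S_{X,Y}` give intervals of a permutation, while
`S_{X,HV}` and `S_{X,HH}` give chains, since suffixes (prefixes) of one permutation are nested. This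
settles the bounds on the classes.

The bound on `S_d` is read off the representation itself. The paths of the clique pairwise meet
without splitting, hence have a common edge (`exists_common_edge`), say a horizontal one, and then
all lie on one supporting path with at most two bends (`exists_frame`). Unfolded, this is a line on
which each clique path is an interval with ends `left` and `right`. For any other one-bend path,
`classified` describes its clique neighbours either by an interval of left ends, or by an interval
of right ends, or by a threshold for one end together with a fixed condition on the other end. For
each degree the two interval types contribute at most `|K| + 1 - d` vertices each, and the two mixed
types, being chains, at most one each: in total `2(|K| + 2 - d)`. Summing over `d < |K|` gives the
quadratic bound. -/

namespace BendENPG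

/-! ### One-bend grid paths as hooks. -/

/-- The path from `(a, b)` along a row to the corner `(c, b)` and from there along a column to
`(c, d)`. Each of the two segments may be trivial. -/
structure Hook where
  c : ℤ
  b : ℤ
  a : ℤ
  d : ℤ

namespace Hook

/-- The hook contains the edge from `(x, y)` to `(x + 1, y)`. -/
def Hor (P : Hook) (x y : ℤ) : Prop :=
  y = P.b ∧ ((P.a ≤ x ∧ x + 1 ≤ P.c) ∨ (P.c ≤ x ∧ x + 1 ≤ P.a))

/-- The hook contains the edge from `(x, y)` to `(x, y + 1)`. -/
def Ver (P : Hook) (x y : ℤ) : Prop :=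
  x = P.c ∧ ((P.b ≤ y ∧ y + 1 ≤ P.d) ∨ (P.d ≤ y ∧ y + 1 ≤ P.b))

/-- Two hooks have a common edge. -/
def Meets (P Q : Hook) : Prop :=
  (∃ x y, P.Hor x y ∧ Q.Hor x y) ∨ ∃ x y, P.Ver x y ∧ Q.Ver x y

/-- At least three of four propositions hold. -/
def Three (p q r s : Prop) : Prop :=
  (p ∧ q ∧ r) ∨ (p ∧ q ∧ s) ∨ (p ∧ r ∧ s) ∨ (q ∧ r ∧ s)

/-- The point `(x, y)` has degree at least `3` in the union of two hooks. -/
def SplitsAt (P Q : Hook) (x y : ℤ) : Prop :=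
  Three (P.Hor x y ∨ Q.Hor x y) (P.Hor (x - 1) y ∨ Q.Hor (x - 1) y)
    (P.Ver x y ∨ Q.Ver x y) (P.Ver x (y - 1) ∨ Q.Ver x (y - 1))

/-- Two hooks have a common edge and no split. -/
def NonSplitting (P Q : Hook) : Prop :=
  P.Meets Q ∧ ∀ x y, ¬ P.SplitsAt Q x y

/-- The hook has the same edges as a subgraph of the grid. -/
def Represents (P : Hook) (A : grid.Subgraph) : Prop :=
  (∀ x y, A.Adj (x, y) (x + 1, y) ↔ P.Hor x y) ∧ ∀ x y, A.Adj (x, y) (x, y + 1) ↔ P.Ver x y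

end Hook

theorem grid_adj_cases {p q : ℤ × ℤ} (h : grid.Adj p q) :
    q = (p.1 + 1, p.2) ∨ q = (p.1 - 1, p.2) ∨ q = (p.1, p.2 + 1) ∨ q = (p.1, p.2 - 1) := by
  obtain ⟨p1, p2⟩ := p
  obtain ⟨q1, q2⟩ := q
  simp only [grid, Prod.mk.injEq] at h ⊢
  rcases h with ⟨h1, h2⟩ | ⟨h1, h2⟩ <;>
    rcases (abs_eq (by norm_num)).1 h2 with h2 | h2 <;> omega

-- Induction on the walk, prepending one edge. The second conjunct is what the induction needs: the
-- new edge is attached at an end of the hook. It prolongs a segment, or turns; a turn is possible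
-- only at an end of a straight path, since otherwise a second bend arises.
set_option maxHeartbeats 2000000 in
theorem exists_hook_of_walk {p q : ℤ × ℤ} (w : grid.Walk p q) (hw : w.IsPath)
    (hb : {x | ∃ a b, w.toSubgraph.Adj x a ∧ w.toSubgraph.Adj x b ∧ a.2 = x.2 ∧
      b.1 = x.1}.Subsingleton) :
    ∃ P : Hook, P.Represents w.toSubgraph ∧ (p = (P.a, P.b) ∨ p = (P.c, P.d)) := by
  induction w with
  | @nil u =>
    refine ⟨⟨u.1, u.2, u.1, u.2⟩, ?_, Or.inl rfl⟩
    constructor <;> intro x y <;>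
      simp [Hook.Hor, Hook.Ver, SimpleGraph.Walk.toSubgraph]
  | @cons u v q h w ih =>
    rw [SimpleGraph.Walk.cons_isPath_iff] at hw
    have hmem : ∀ x y, w.toSubgraph.Adj x y → x ≠ u ∧ y ≠ u := by
      intro x y hxy
      have h1 := w.mem_verts_toSubgraph.1 (w.toSubgraph.edge_vert hxy)
      have h2 := w.mem_verts_toSubgraph.1 (w.toSubgraph.edge_vert hxy.symm)
      exact ⟨fun e => hw.2 (e ▸ h1), fun e => hw.2 (e ▸ h2)⟩
    have hadj : ∀ x y, (SimpleGraph.Walk.cons h w).toSubgraph.Adj x y ↔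
        ((u = x ∧ v = y) ∨ (u = y ∧ v = x)) ∨ w.toSubgraph.Adj x y := by
      intro x y
      simp [SimpleGraph.Walk.toSubgraph]
    have hsub : ∀ {x y}, w.toSubgraph.Adj x y →
        (SimpleGraph.Walk.cons h w).toSubgraph.Adj x y := fun {x y} e => (hadj x y).2 (Or.inr e)
    obtain ⟨⟨c, b, a, d⟩, ⟨hH, hV⟩, hp⟩ := ih hw.1 (by
      intro x hx y hy
      obtain ⟨a, b, h1, h2, h3⟩ := hx
      obtain ⟨a', b', h1', h2', h3'⟩ := hy
      exact hb ⟨a, b, hsub h1, hsub h2, h3⟩ ⟨a', b', hsub h1', hsub h2', h3'⟩)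
    have huv : (SimpleGraph.Walk.cons h w).toSubgraph.Adj v u :=
      (hadj v u).2 (Or.inl (Or.inr ⟨rfl, rfl⟩))
    have hH' : ∀ x y, Hook.Hor ⟨c, b, a, d⟩ x y → (x, y) ≠ u ∧ (x + 1, y) ≠ u :=
      fun x y e => hmem _ _ ((hH x y).2 e)
    have hV' : ∀ x y, Hook.Ver ⟨c, b, a, d⟩ x y → (x, y) ≠ u ∧ (x, y + 1) ≠ u :=
      fun x y e => hmem _ _ ((hV x y).2 e)
    have hor_of_ne : a ≠ c → ∃ z, w.toSubgraph.Adj (c, b) (z, b) := by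
      intro hne
      rcases lt_or_gt_of_ne hne with h1 | h1
      · refine ⟨c - 1, ?_⟩
        have := (hH (c - 1) b).2 ⟨rfl, by dsimp only; omega⟩
        rw [sub_add_cancel] at this
        exact this.symm
      · exact ⟨c + 1, (hH c b).2 ⟨rfl, by dsimp only; omega⟩⟩
    have ver_of_ne : b ≠ d → ∃ z, w.toSubgraph.Adj (c, b) (c, z) := by
      intro hne
      rcases lt_or_gt_of_ne hne with h1 | h1
      · exact ⟨b + 1, (hV c b).2 ⟨rfl, by dsimp only; omega⟩⟩
      · refine ⟨b - 1, ?_⟩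
        have := (hV c (b - 1)).2 ⟨rfl, by dsimp only; omega⟩
        rw [sub_add_cancel] at this
        exact this.symm
    have end_hor : a ≠ c → ∃ z, w.toSubgraph.Adj (a, b) (z, b) := by
      intro hne
      rcases lt_or_gt_of_ne hne with h1 | h1
      · exact ⟨a + 1, (hH a b).2 ⟨rfl, by dsimp only; omega⟩⟩
      · refine ⟨a - 1, ?_⟩
        have := (hH (a - 1) b).2 ⟨rfl, by dsimp only; omega⟩
        rw [sub_add_cancel] at this
        exact this.symm
    have end_ver : b ≠ d → ∃ z, w.toSubgraph.Adj (c, d) (c, z) := by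
      intro hne
      rcases lt_or_gt_of_ne hne with h1 | h1
      · refine ⟨d - 1, ?_⟩
        have := (hV c (d - 1)).2 ⟨rfl, by dsimp only; omega⟩
        rw [sub_add_cancel] at this
        exact this.symm
      · exact ⟨d + 1, (hV c d).2 ⟨rfl, by dsimp only; omega⟩⟩
    have corner : a ≠ c → b ≠ d → (c, b) ∈ {x | ∃ a b,
        (SimpleGraph.Walk.cons h w).toSubgraph.Adj x a ∧
        (SimpleGraph.Walk.cons h w).toSubgraph.Adj x b ∧ a.2 = x.2 ∧ b.1 = x.1} := by
      intro h1 h2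
      obtain ⟨z, hz⟩ := hor_of_ne h1
      obtain ⟨t, ht⟩ := ver_of_ne h2
      exact ⟨(z, b), (c, t), hsub hz, hsub ht, rfl, rfl⟩
    -- Turning at the end of a nontrivial row creates a bend other than the corner `(c, b)`, so the
    -- column must be trivial.
    have bend_start : v = (a, b) → u.1 = a → a ≠ c → b = d := by
      intro hv hu hne
      by_contra hbd
      obtain ⟨z, hz⟩ := end_hor hne
      have := hb (corner hne hbd) (show (a, b) ∈ _ from ⟨(z, b), u, hsub hz, hv ▸ huv, rfl, hu⟩)
      exact hne (congrArg Prod.fst this).symm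
    have bend_end : v = (c, d) → u.2 = d → b ≠ d → a = c := by
      intro hv hu hne
      by_contra hac
      obtain ⟨z, hz⟩ := end_ver hne
      have := hb (corner hac hne) (show (c, d) ∈ _ from ⟨u, (c, z), hv ▸ huv, hsub hz, hu, rfl⟩)
      exact hne (congrArg Prod.snd this)
    clear corner hor_of_ne ver_of_ne end_hor end_ver hb hmem hsub huv ih
    have h' := grid_adj_cases h
    obtain ⟨u1, u2⟩ := u
    obtain ⟨v1, v2⟩ := v
    simp only [Prod.mk.injEq, ne_eq, Hook.Hor, Hook.Ver, not_and_or] at h' hp hH' hV' bend_start bend_end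
    have fin : ∀ P : Hook, (∀ x y, ((((u1 = x ∧ u2 = y) ∧ (v1 = x + 1 ∧ v2 = y)) ∨
          ((u1 = x + 1 ∧ u2 = y) ∧ (v1 = x ∧ v2 = y))) ∨ Hook.Hor ⟨c, b, a, d⟩ x y) ↔ P.Hor x y) →
        (∀ x y, ((((u1 = x ∧ u2 = y) ∧ (v1 = x ∧ v2 = y + 1)) ∨
          ((u1 = x ∧ u2 = y + 1) ∧ (v1 = x ∧ v2 = y))) ∨ Hook.Ver ⟨c, b, a, d⟩ x y) ↔ P.Ver x y) →
        P.Represents (SimpleGraph.Walk.cons h w).toSubgraph := by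
      intro P h1 h2
      refine ⟨fun x y => ?_, fun x y => ?_⟩
      · rw [hadj, hH, ← h1]; simp only [Prod.mk.injEq]
      · rw [hadj, hV, ← h2]; simp only [Prod.mk.injEq]
    simp only [Hook.Hor, Hook.Ver] at fin
    rcases hp with ⟨rfl, rfl⟩ | ⟨rfl, rfl⟩
    · by_cases hu : u2 = v2
      · have k1 := hH' v1 v2
        have k2 := hH' (v1 - 1) v2
        -- The walk is simple, so the new edge leads away from the corner instead of back along the
        -- row.
        have k3 : (v1 < c → u1 = v1 - 1) ∧ (c < v1 → u1 = v1 + 1) := by omega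
        clear k1 k2
        refine ⟨⟨c, v2, u1, d⟩, fin _ ?_ ?_, Or.inl (by rw [hu])⟩
        · intro x y; dsimp only; clear fin hH' hV' bend_start bend_end hH hV hadj h; grind
        · intro x y; dsimp only; clear fin hH' hV' bend_start bend_end hH hV hadj h; grind
      · by_cases hac : v1 = c
        · have k1 := hV' v1 v2
          have k2 := hV' v1 (v2 - 1)
          have k3 : (v2 < d → u2 = v2 - 1) ∧ (d < v2 → u2 = v2 + 1) := by omega
          clear k1 k2
          refine ⟨⟨c, u2, u1, d⟩, fin _ ?_ ?_, Or.inl rfl⟩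
          · intro x y; dsimp only; clear fin hH' hV' bend_start bend_end hH hV hadj h; grind
          · intro x y; dsimp only; clear fin hH' hV' bend_start bend_end hH hV hadj h; grind
        · have k := bend_start ⟨rfl, rfl⟩ (by omega) hac
          -- The path was a straight row: its old start becomes the corner, and its old corner the
          -- free end of the row.
          refine ⟨⟨v1, v2, c, u2⟩, fin _ ?_ ?_, Or.inr (by rw [show u1 = v1 by omega])⟩
          · intro x y; dsimp only; clear fin hH' hV' bend_start bend_end hH hV hadj h; grind
          · intro x y; dsimp only; clear fin hH' hV' bend_start bend_end hH hV hadj h; grind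
    · by_cases hu : u1 = v1
      · have k1 := hV' v1 v2
        have k2 := hV' v1 (v2 - 1)
        have k3 : (v2 < b → u2 = v2 - 1) ∧ (b < v2 → u2 = v2 + 1) := by omega
        clear k1 k2
        refine ⟨⟨v1, b, a, u2⟩, fin _ ?_ ?_, Or.inr (by rw [hu])⟩
        · intro x y; dsimp only; clear fin hH' hV' bend_start bend_end hH hV hadj h; grind
        · intro x y; dsimp only; clear fin hH' hV' bend_start bend_end hH hV hadj h; grind
      · by_cases hac : b = v2
        · have k1 := hH' v1 v2
          have k2 := hH' (v1 - 1) v2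
          have k3 : (v1 < a → u1 = v1 - 1) ∧ (a < v1 → u1 = v1 + 1) := by omega
          clear k1 k2
          refine ⟨⟨u1, b, a, u2⟩, fin _ ?_ ?_, Or.inr rfl⟩
          · intro x y; dsimp only; clear fin hH' hV' bend_start bend_end hH hV hadj h; grind
          · intro x y; dsimp only; clear fin hH' hV' bend_start bend_end hH hV hadj h; grind
        · have k := bend_end ⟨rfl, rfl⟩ (by omega) hac
          refine ⟨⟨v1, v2, u1, b⟩, fin _ ?_ ?_, Or.inl (by rw [show u2 = v2 by omega])⟩
          · intro x y; dsimp only; clear fin hH' hV' bend_start bend_end hH hV hadj h; grind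
          · intro x y; dsimp only; clear fin hH' hV' bend_start bend_end hH hV hadj h; grind

theorem GridPath.exists_hook (P : GridPath) (h : P.bends.encard ≤ (1 : ℕ)) :
    ∃ Q : Hook, Q.Represents P.graph := by
  obtain ⟨Q, hQ, -⟩ := exists_hook_of_walk P.walk P.isPath
    (Set.encard_le_one_iff_subsingleton.1 (by simpa [GridPath.bends, GridPath.graph] using h))
  exact ⟨Q, hQ⟩

theorem three_le_encard_neighborSet_iff (A : grid.Subgraph) (x y : ℤ) :
    3 ≤ (A.neighborSet (x, y)).encard ↔ Hook.Three (A.Adj (x, y) (x + 1, y))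
      (A.Adj (x - 1, y) (x, y)) (A.Adj (x, y) (x, y + 1)) (A.Adj (x, y - 1) (x, y)) := by
  rw [A.adj_comm (x - 1, y), A.adj_comm (x, y - 1)]
  constructor
  · intro h
    by_contra hT
    have key : ∀ p q : ℤ × ℤ, ¬ A.neighborSet (x, y) ⊆ {p, q} := by
      intro p q hs
      have h1 := (Set.encard_le_encard hs).trans (Set.encard_insert_le {q} p)
      rw [Set.encard_singleton, one_add_one_eq_two] at h1
      exact absurd (h.trans h1) (by norm_num)
    have hcases : ∀ q, A.Adj (x, y) q →
        q = (x + 1, y) ∨ q = (x - 1, y) ∨ q = (x, y + 1) ∨ q = (x, y - 1) :=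
      fun q hq => grid_adj_cases (A.adj_sub hq)
    have pairs : ∀ p q, (∀ t, A.Adj (x, y) t → t = p ∨ t = q) → False :=
      fun p q hpq => key p q fun t ht => hpq t ht
    -- If at most two of the four directions occur, all neighbours lie in one of these six pairs.
    have k1 := pairs (x + 1, y) (x - 1, y)
    have k2 := pairs (x + 1, y) (x, y + 1)
    have k3 := pairs (x + 1, y) (x, y - 1)
    have k4 := pairs (x - 1, y) (x, y + 1)
    have k5 := pairs (x - 1, y) (x, y - 1)
    have k6 := pairs (x, y + 1) (x, y - 1)
    unfold Hook.Three at hT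
    grind
  · have key : ∀ p q r : ℤ × ℤ, A.Adj (x, y) p → A.Adj (x, y) q → A.Adj (x, y) r → p ≠ q → p ≠ r →
        q ≠ r → 3 ≤ (A.neighborSet (x, y)).encard := by
      intro p q r hp hq hr h1 h2 h3
      rw [← Set.encard_eq_three.2 ⟨p, q, r, h1, h2, h3, rfl⟩]
      apply Set.encard_le_encard
      rintro t (rfl | rfl | rfl) <;> assumption
    rintro (⟨h1, h2, h3⟩ | ⟨h1, h2, h3⟩ | ⟨h1, h2, h3⟩ | ⟨h1, h2, h3⟩) <;>
      refine key _ _ _ h1 h2 h3 ?_ ?_ ?_ <;> simp only [ne_eq, Prod.mk.injEq] <;> omega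

theorem Hook.nonSplitting_iff {P Q : GridPath} {A B : Hook} (hA : A.Represents P.graph)
    (hB : B.Represents Q.graph) : P.NonSplitting Q ↔ A.NonSplitting B := by
  unfold GridPath.NonSplitting Hook.NonSplitting
  refine and_congr ?_ ?_
  · constructor
    · rintro ⟨e, h1, h2⟩
      induction e with | _ p q
      rw [SimpleGraph.Subgraph.mem_edgeSet] at h1 h2
      obtain ⟨x, y⟩ := p
      rcases grid_adj_cases (P.graph.adj_sub h1) with rfl | rfl | rfl | rfl
      · exact Or.inl ⟨x, y, (hA.1 _ _).1 h1, (hB.1 _ _).1 h2⟩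
      · refine Or.inl ⟨x - 1, y, (hA.1 _ _).1 ?_, (hB.1 _ _).1 ?_⟩ <;> rw [sub_add_cancel]
        exacts [h1.symm, h2.symm]
      · exact Or.inr ⟨x, y, (hA.2 _ _).1 h1, (hB.2 _ _).1 h2⟩
      · refine Or.inr ⟨x, y - 1, (hA.2 _ _).1 ?_, (hB.2 _ _).1 ?_⟩ <;> rw [sub_add_cancel]
        exacts [h1.symm, h2.symm]
    · rintro (⟨x, y, h1, h2⟩ | ⟨x, y, h1, h2⟩)
      · exact ⟨s((x, y), (x + 1, y)), (hA.1 _ _).2 h1, (hB.1 _ _).2 h2⟩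
      · exact ⟨s((x, y), (x, y + 1)), (hA.2 _ _).2 h1, (hB.2 _ _).2 h2⟩
  · rw [Set.eq_empty_iff_forall_notMem, Prod.forall]
    refine forall_congr' fun x => forall_congr' fun y => not_congr ?_
    have e1 := hA.1 (x - 1) y
    have e2 := hB.1 (x - 1) y
    have e3 := hA.2 x (y - 1)
    have e4 := hB.2 x (y - 1)
    rw [sub_add_cancel] at e1 e2 e3 e4
    simp only [GridPath.splits, Set.mem_ofPred_eq, three_le_encard_neighborSet_iff,
      SimpleGraph.Subgraph.sup_adj, Hook.SplitsAt, hA.1, hB.1, hA.2, hB.2, e1, e2, e3, e4]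

/-! ### Symmetries of the grid. -/

namespace Hook

/-- The image of a hook under the reflection in the diagonal. -/
def transpose (P : Hook) : Hook := ⟨P.b, P.c, P.d, P.a⟩

/-- The image of a hook under the reflection in the vertical axis. -/
def mirrorX (P : Hook) : Hook := ⟨-P.c, P.b, -P.a, P.d⟩

/-- The image of a hook under the reflection in the horizontal axis. -/
def mirrorY (P : Hook) : Hook := ⟨P.c, -P.b, P.a, -P.d⟩

theorem hor_transpose (P : Hook) (x y : ℤ) : P.transpose.Hor x y ↔ P.Ver y x := by
  simp only [transpose, Hor, Ver]; omega

theorem ver_transpose (P : Hook) (x y : ℤ) : P.transpose.Ver x y ↔ P.Hor y x := by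
  simp only [transpose, Hor, Ver]; omega

/-- The left end of an edge becomes its right end under the reflection, whence the shift by one. -/
theorem hor_mirrorX (P : Hook) (x y : ℤ) : P.mirrorX.Hor x y ↔ P.Hor (-x - 1) y := by
  simp only [mirrorX, Hor]; omega

theorem ver_mirrorX (P : Hook) (x y : ℤ) : P.mirrorX.Ver x y ↔ P.Ver (-x) y := by
  simp only [mirrorX, Ver]; omega

theorem hor_mirrorY (P : Hook) (x y : ℤ) : P.mirrorY.Hor x y ↔ P.Hor x (-y) := by
  simp only [mirrorY, Hor]; omega

theorem ver_mirrorY (P : Hook) (x y : ℤ) : P.mirrorY.Ver x y ↔ P.Ver x (-y - 1) := by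
  simp only [mirrorY, Ver]; omega

theorem Three.rotate {p q r s : Prop} (h : Three p q r s) : Three r s p q := by
  unfold Three at *; tauto

theorem Three.swap {p q r s : Prop} (h : Three p q r s) : Three q p r s := by
  unfold Three at *; tauto

theorem NonSplitting.transpose {P Q : Hook} (h : P.NonSplitting Q) :
    P.transpose.NonSplitting Q.transpose := by
  refine ⟨?_, fun x y hs => h.2 y x ?_⟩
  · rcases h.1 with ⟨x, y, h1, h2⟩ | ⟨x, y, h1, h2⟩
    · exact Or.inr ⟨y, x, by rwa [ver_transpose], by rwa [ver_transpose]⟩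
    · exact Or.inl ⟨y, x, by rwa [hor_transpose], by rwa [hor_transpose]⟩
  · simp only [SplitsAt, hor_transpose, ver_transpose] at hs ⊢
    exact hs.rotate

theorem nonSplitting_transpose {P Q : Hook} :
    P.transpose.NonSplitting Q.transpose ↔ P.NonSplitting Q :=
  ⟨fun h => h.transpose, fun h => h.transpose⟩

theorem NonSplitting.mirrorX {P Q : Hook} (h : P.NonSplitting Q) :
    P.mirrorX.NonSplitting Q.mirrorX := by
  refine ⟨?_, fun x y hs => h.2 (-x) y ?_⟩
  · rcases h.1 with ⟨x, y, h1, h2⟩ | ⟨x, y, h1, h2⟩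
    · refine Or.inl ⟨-x - 1, y, ?_, ?_⟩ <;> rw [hor_mirrorX, show -(-x - 1) - 1 = x by ring] <;>
        assumption
    · exact Or.inr ⟨-x, y, by rwa [ver_mirrorX, neg_neg], by rwa [ver_mirrorX, neg_neg]⟩
  · simp only [SplitsAt, hor_mirrorX, ver_mirrorX, show -(x - 1) - 1 = -x by ring] at hs ⊢
    exact hs.swap

theorem nonSplitting_mirrorX {P Q : Hook} :
    P.mirrorX.NonSplitting Q.mirrorX ↔ P.NonSplitting Q := by
  refine ⟨fun h => ?_, fun h => h.mirrorX⟩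
  simpa only [Hook.mirrorX, neg_neg] using h.mirrorX

theorem NonSplitting.mirrorY {P Q : Hook} (h : P.NonSplitting Q) :
    P.mirrorY.NonSplitting Q.mirrorY := by
  refine ⟨?_, fun x y hs => h.2 x (-y) ?_⟩
  · rcases h.1 with ⟨x, y, h1, h2⟩ | ⟨x, y, h1, h2⟩
    · exact Or.inl ⟨x, -y, by rwa [hor_mirrorY, neg_neg], by rwa [hor_mirrorY, neg_neg]⟩
    · refine Or.inr ⟨x, -y - 1, ?_, ?_⟩ <;> rw [ver_mirrorY, show -(-y - 1) - 1 = y by ring] <;>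
        assumption
  · simp only [SplitsAt, hor_mirrorY, ver_mirrorY, show -(y - 1) - 1 = -y by ring] at hs ⊢
    exact hs.rotate.swap.rotate

theorem nonSplitting_mirrorY {P Q : Hook} :
    P.mirrorY.NonSplitting Q.mirrorY ↔ P.NonSplitting Q := by
  refine ⟨fun h => ?_, fun h => h.mirrorY⟩
  simpa only [Hook.mirrorY, neg_neg] using h.mirrorY

theorem not_splitsAt_self (P : Hook) (x y : ℤ) : ¬ P.SplitsAt P x y := by
  simp only [SplitsAt, Three, Hor, Ver]; omega

/-! ### A Helly property: the common edge of a clique. -/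

theorem exists_common_hor {V : Type u} {K : Finset V} (hK : K.Nonempty) (P : V → Hook)
    (h : ∀ u ∈ K, ∀ v ∈ K, ∃ x y, (P u).Hor x y ∧ (P v).Hor x y) :
    ∃ x y, ∀ v ∈ K, (P v).Hor x y := by
  -- All rows agree, and by the Helly argument for intervals the leftmost edge of the row that
  -- starts furthest to the right lies in all the rows.
  obtain ⟨u, hu, hmax⟩ := K.exists_max_image (fun v => min (P v).a (P v).c) hK
  refine ⟨min (P u).a (P u).c, (P u).b, fun v hv => ?_⟩
  obtain ⟨x, y, h1, h2⟩ := h u hu v hv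
  have := hmax v hv
  simp only [Hor] at *
  omega

/-- A finite family of hooks which pairwise share edges without splitting has a common edge. -/
theorem exists_common_edge {V : Type u} {K : Finset V} (hK : K.Nonempty) (P : V → Hook)
    (h : ∀ u ∈ K, ∀ v ∈ K, (P u).NonSplitting (P v)) :
    (∃ x y, ∀ v ∈ K, (P v).Hor x y) ∨ ∃ x y, ∀ v ∈ K, (P v).transpose.Hor x y := by
  by_cases hH : ∀ u ∈ K, ∀ v ∈ K, ∃ x y, (P u).Hor x y ∧ (P v).Hor x y
  · exact Or.inl (exists_common_hor hK P hH)
  by_cases hV : ∀ u ∈ K, ∀ v ∈ K, ∃ x y, (P u).Ver x y ∧ (P v).Ver x y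
  · refine Or.inr (exists_common_hor hK (fun v => (P v).transpose) fun u hu v hv => ?_)
    obtain ⟨x, y, h1, h2⟩ := hV u hu v hv
    exact ⟨y, x, by rwa [hor_transpose], by rwa [hor_transpose]⟩
  exfalso
  -- Two such hooks share a column edge. If both had edges on row `r`, they would have a common
  -- corner there and leave it in opposite directions, which together with the column is a split.
  have key : ∀ A B : Hook, A.NonSplitting B → (∀ x y, A.Hor x y → ¬ B.Hor x y) →
      ∃ c, A.c = c ∧ B.c = c ∧ ∀ r, (∀ x, ¬ A.Hor x r) ∨ ∀ x, ¬ B.Hor x r := by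
    intro A B hAB hno
    rcases hAB.1 with ⟨x, y, h1, h2⟩ | ⟨x, y, h1, h2⟩
    · exact absurd h2 (hno x y h1)
    refine ⟨x, h1.1.symm, h2.1.symm, fun r => ?_⟩
    by_contra! hr
    obtain ⟨⟨x1, e1⟩, x2, e2⟩ := hr
    have n1 := hno x r
    have n2 := hno (x - 1) r
    have n3 := hAB.2 x r
    have m1 : A.Hor x r ∨ A.Hor (x - 1) r := by simp only [Hor, Ver] at *; omega
    have m2 : B.Hor x r ∨ B.Hor (x - 1) r := by simp only [Hor, Ver] at *; omega
    have m3 : A.Ver x r ∨ A.Ver x (r - 1) := by simp only [Hor, Ver] at *; omega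
    unfold SplitsAt Three at n3
    clear hno hAB h1 h2 e1 e2
    tauto
  push Not at hH hV
  obtain ⟨u, hu, v, hv, huv⟩ := hH
  obtain ⟨s, hs, t, ht, hst⟩ := hV
  obtain ⟨c, hc1, hc2, hc⟩ := key _ _ (h u hu v hv) huv
  obtain ⟨r, hr1, hr2, hr⟩ := key _ _ (h s hs t ht).transpose
    (fun x y => by rw [hor_transpose, hor_transpose]; exact hst y x)
  simp only [hor_transpose] at hr
  -- A common row edge would lie on the row `r` of `B`, which `A` avoids; a common column edge on
  -- the column `c` of `A`, which `B` avoids. Each of the two bad pairs supplies one of these hooks.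
  have fin : ∀ A B : Hook, A.c = c → (∀ x, ¬ A.Hor x r) → B.transpose.c = r →
      (∀ x, ¬ B.Ver c x) → ¬ A.NonSplitting B := by
    rintro A B h1 h2 h3 h4 ⟨⟨x, y, h5, h6⟩ | ⟨x, y, h5, h6⟩, -⟩
    · exact h2 x ((h6.1.trans h3) ▸ h5)
    · exact h4 y ((h5.1.trans h1) ▸ h6)
  rcases hc r with e1 | e1 <;> rcases hr c with e2 | e2
  · exact fin _ _ hc1 e1 hr1 e2 (h u hu s hs)
  · exact fin _ _ hc1 e1 hr2 e2 (h u hu t ht)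
  · exact fin _ _ hc2 e1 hr1 e2 (h v hv s hs)
  · exact fin _ _ hc2 e1 hr2 e2 (h v hv t ht)

/-! ### The supporting path of a clique. -/

/-- Coordinates of the common supporting path of a family of hooks containing the edge from
`(x₀, y₀)` to `(x₀ + 1, y₀)`: it bends at `(p, y₀)` and at `(q, y₀)`, upwards if `i`, respectively
`j`, holds, and downwards otherwise. -/
structure Frame (x₀ y₀ p q : ℤ) (i j : Prop) (P : Hook) : Prop where
  edge : P.Hor x₀ y₀
  p_le_a : p ≤ P.a
  p_le_c : p ≤ P.c
  a_le_q : P.a ≤ q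
  c_le_q : P.c ≤ q
  bend_left : P.c ≤ x₀ → P.d ≠ y₀ → P.c = p ∧ (y₀ < P.d ↔ i)
  bend_right : x₀ < P.c → P.d ≠ y₀ → P.c = q ∧ (y₀ < P.d ↔ j)

/-- The position of the left end of a hook on the supporting path. -/
def left (x₀ : ℤ) (P : Hook) : ℤ := if P.c ≤ x₀ then P.c - (P.d - P.b).natAbs else P.a

/-- The position of the right end of a hook on the supporting path. -/
def right (x₀ : ℤ) (P : Hook) : ℤ := if P.c ≤ x₀ then P.a else P.c + (P.d - P.b).natAbs

theorem Frame.mirrorX {x₀ y₀ p q : ℤ} {i j : Prop} {P : Hook} (h : Frame x₀ y₀ p q i j P) :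
    Frame (-x₀ - 1) y₀ (-q) (-p) j i P.mirrorX := by
  obtain ⟨h1, h2, h3, h4, h5, h6, h7⟩ := h
  refine ⟨by rw [hor_mirrorX, show -(-x₀ - 1) - 1 = x₀ by ring]; exact h1, ?_, ?_, ?_, ?_, ?_, ?_⟩ <;>
    simp only [Hook.mirrorX]
  · omega
  · omega
  · omega
  · omega
  · intro h8 h9
    have := h7 (by omega) h9
    exact ⟨by omega, this.2⟩
  · intro h8 h9
    have := h6 (by omega) h9
    exact ⟨by omega, this.2⟩

theorem Frame.mirrorY {x₀ y₀ p q : ℤ} {i j : Prop} {P : Hook} (h : Frame x₀ y₀ p q i j P) :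
    Frame x₀ (-y₀) p q (¬ i) (¬ j) P.mirrorY := by
  obtain ⟨h1, h2, h3, h4, h5, h6, h7⟩ := h
  refine ⟨by rw [hor_mirrorY, neg_neg]; exact h1, h2, h3, h4, h5, ?_, ?_⟩ <;>
    simp only [Hook.mirrorY]
  · intro h8 h9
    have := h6 h8 (by omega)
    exact ⟨this.1, by rw [← this.2]; omega⟩
  · intro h8 h9
    have := h7 h8 (by omega)
    exact ⟨this.1, by rw [← this.2]; omega⟩

theorem left_mirrorX (x₀ : ℤ) (P : Hook) :
    left (-x₀ - 1) P.mirrorX = -right x₀ P := by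
  simp only [left, right, Hook.mirrorX]
  split_ifs <;> omega

theorem right_mirrorX (x₀ : ℤ) (P : Hook) :
    right (-x₀ - 1) P.mirrorX = -left x₀ P := by
  simp only [left, right, Hook.mirrorX]
  split_ifs <;> omega

theorem left_mirrorY (x₀ : ℤ) (P : Hook) : left x₀ P.mirrorY = left x₀ P := by
  simp only [left, Hook.mirrorY]
  split_ifs <;> omega

theorem right_mirrorY (x₀ : ℤ) (P : Hook) : right x₀ P.mirrorY = right x₀ P := by
  simp only [right, Hook.mirrorY]
  split_ifs <;> omega

/-- If `Q` had the row edge to the left of the corner of `P`, both row edges and a column edge would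
meet there. -/
theorem bend_left_le {P Q : Hook} {x₀ y₀ : ℤ} (hP : P.Hor x₀ y₀) (hQ : Q.Hor x₀ y₀)
    (hc : P.c ≤ x₀) (hd : P.d ≠ y₀) (h : ∀ x y, ¬ P.SplitsAt Q x y) :
    P.c ≤ Q.a ∧ P.c ≤ Q.c := by
  have h1 : P.Hor P.c y₀ := ⟨hP.1, by simp only [Hor] at hP; omega⟩
  have h2 : P.Ver P.c y₀ ∨ P.Ver P.c (y₀ - 1) := by
    simp only [Hor, Ver, true_and] at *; omega
  have h3 : ¬ Q.Hor (P.c - 1) y₀ := fun h3 => h P.c y₀ (by unfold SplitsAt Three; tauto)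
  simp only [Hor] at hP hQ h3
  omega

theorem bend_left_side {P Q : Hook} {x₀ y₀ : ℤ} (hP : P.Hor x₀ y₀) (hQ : Q.Hor x₀ y₀)
    (hc : P.c ≤ x₀) (hd : P.d ≠ y₀) (hd' : Q.d ≠ y₀) (hPQ : Q.c = P.c)
    (h : ∀ x y, ¬ P.SplitsAt Q x y) : y₀ < Q.d ↔ y₀ < P.d := by
  have h1 : P.Hor P.c y₀ := ⟨hP.1, by simp only [Hor] at hP; omega⟩
  have h2 := h P.c y₀
  have h3 : y₀ < P.d → P.Ver P.c y₀ := fun e => ⟨rfl, by rw [← hP.1]; omega⟩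
  have h4 : P.d < y₀ → P.Ver P.c (y₀ - 1) := fun e => ⟨rfl, by rw [← hP.1]; omega⟩
  have h5 : y₀ < Q.d → Q.Ver P.c y₀ := fun e => ⟨hPQ.symm, by rw [← hQ.1]; omega⟩
  have h6 : Q.d < y₀ → Q.Ver P.c (y₀ - 1) := fun e => ⟨hPQ.symm, by rw [← hQ.1]; omega⟩
  rcases lt_or_gt_of_ne hd with e | e <;> rcases lt_or_gt_of_ne hd' with e' | e'
  · omega
  · exact absurd (Or.inr (Or.inr (Or.inl ⟨Or.inl h1, Or.inr (h5 e'), Or.inl (h4 e)⟩))) h2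
  · exact absurd (Or.inr (Or.inr (Or.inl ⟨Or.inl h1, Or.inl (h3 e), Or.inr (h6 e')⟩))) h2
  · omega

theorem exists_frame_left {V : Type u} {K : Finset V} (P : V → Hook) {x₀ y₀ : ℤ}
    (h : ∀ u ∈ K, ∀ v ∈ K, (P u).NonSplitting (P v)) (he : ∀ v ∈ K, (P v).Hor x₀ y₀) :
    ∃ p ≤ x₀, ∃ i : Prop, ∀ v ∈ K, p ≤ (P v).a ∧ p ≤ (P v).c ∧
      ((P v).c ≤ x₀ → (P v).d ≠ y₀ → (P v).c = p ∧ (y₀ < (P v).d ↔ i)) := by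
  by_cases hb : ∃ u ∈ K, (P u).c ≤ x₀ ∧ (P u).d ≠ y₀
  · obtain ⟨u, hu, hc, hd⟩ := hb
    refine ⟨(P u).c, hc, y₀ < (P u).d, fun v hv => ?_⟩
    have h1 := he u hu
    have h2 := he v hv
    obtain ⟨h3, h4⟩ := bend_left_le h1 h2 hc hd (h u hu v hv).2
    refine ⟨h3, h4, fun h5 h6 => ?_⟩
    obtain ⟨h7, h8⟩ := bend_left_le h2 h1 h5 h6 (h v hv u hu).2
    exact ⟨by omega, bend_left_side h1 h2 hc hd h6 (by omega) (h u hu v hv).2⟩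
  · push Not at hb
    rcases K.eq_empty_or_nonempty with rfl | hK
    · exact ⟨x₀, le_rfl, True, by simp⟩
    -- No hook leaves the row on the left, so `p` is just the leftmost point reached and the choice
    -- of `i` is immaterial.
    obtain ⟨u, hu, hmin⟩ := K.exists_min_image (fun v => min (P v).a (P v).c) hK
    have hu := he u hu
    refine ⟨min (P u).a (P u).c, by simp only [Hor] at hu; omega, True, fun v hv => ?_⟩
    have := hmin v hv
    exact ⟨by omega, by omega, fun h1 h2 => absurd (hb v hv h1) h2⟩

theorem exists_frame {V : Type u} {K : Finset V} (P : V → Hook) {x₀ y₀ : ℤ}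
    (h : ∀ u ∈ K, ∀ v ∈ K, (P u).NonSplitting (P v)) (he : ∀ v ∈ K, (P v).Hor x₀ y₀) :
    ∃ p q i j, p ≤ x₀ ∧ x₀ < q ∧ ∀ v ∈ K, Frame x₀ y₀ p q i j (P v) := by
  obtain ⟨p, hp, i, hi⟩ := exists_frame_left P h he
  obtain ⟨q, hq, j, hj⟩ := exists_frame_left (fun v => (P v).mirrorX) (x₀ := -x₀ - 1) (y₀ := y₀)
    (fun u hu v hv => (h u hu v hv).mirrorX) (fun v hv => by
      rw [hor_mirrorX, show -(-x₀ - 1) - 1 = x₀ by ring]; exact he v hv)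
  refine ⟨p, -q, i, j, hp, by omega, fun v hv => ?_⟩
  obtain ⟨h1, h2, h3⟩ := hi v hv
  obtain ⟨h4, h5, h6⟩ := hj v hv
  simp only [Hook.mirrorX] at h4 h5 h6
  refine ⟨he v hv, h1, h2, by omega, by omega, h3, fun h7 h8 => ?_⟩
  have := h6 (by omega) h8
  exact ⟨by omega, this.2⟩

end Hook

/-! ### Adjacency in terms of positions on the supporting path. -/

namespace Hook

theorem splitsAt_of_hor {P Q : Hook} {x y : ℤ} (h1 : P.Hor x y ∨ Q.Hor x y)
    (h2 : P.Hor (x - 1) y ∨ Q.Hor (x - 1) y)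
    (h3 : (P.Ver x y ∨ Q.Ver x y) ∨ P.Ver x (y - 1) ∨ Q.Ver x (y - 1)) : P.SplitsAt Q x y := by
  rcases h3 with h3 | h3
  · exact Or.inl ⟨h1, h2, h3⟩
  · exact Or.inr (Or.inl ⟨h1, h2, h3⟩)

theorem splitsAt_of_ver {P Q : Hook} {x y : ℤ} (h1 : P.Ver x y ∨ Q.Ver x y)
    (h2 : P.Ver x (y - 1) ∨ Q.Ver x (y - 1))
    (h3 : (P.Hor x y ∨ Q.Hor x y) ∨ P.Hor (x - 1) y ∨ Q.Hor (x - 1) y) : P.SplitsAt Q x y := by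
  rcases h3 with h3 | h3
  · exact Or.inr (Or.inr (Or.inl ⟨h3, h1, h2⟩))
  · exact Or.inr (Or.inr (Or.inr ⟨h3, h1, h2⟩))

/-- Three of the four directions always include two opposite ones, so every split is a straight
passage with a perpendicular edge. -/
theorem SplitsAt.cases {P Q : Hook} {x y : ℤ} (h : P.SplitsAt Q x y) :
    ((P.Hor x y ∨ Q.Hor x y) ∧ (P.Hor (x - 1) y ∨ Q.Hor (x - 1) y) ∧
      ((P.Ver x y ∨ Q.Ver x y) ∨ P.Ver x (y - 1) ∨ Q.Ver x (y - 1))) ∨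
    ((P.Ver x y ∨ Q.Ver x y) ∧ (P.Ver x (y - 1) ∨ Q.Ver x (y - 1)) ∧
      ((P.Hor x y ∨ Q.Hor x y) ∨ P.Hor (x - 1) y ∨ Q.Hor (x - 1) y)) := by
  rcases h with ⟨h1, h2, h3⟩ | ⟨h1, h2, h3⟩ | ⟨h1, h2, h3⟩ | ⟨h1, h2, h3⟩
  · exact Or.inl ⟨h1, h2, Or.inl h3⟩
  · exact Or.inl ⟨h1, h2, Or.inr h3⟩
  · exact Or.inr ⟨h2, h3, Or.inl h1⟩
  · exact Or.inr ⟨h2, h3, Or.inr h1⟩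

section

variable {x₀ y₀ p q : ℤ} {i j : Prop} {s v : Hook}

theorem Frame.left_le (hv : Frame x₀ y₀ p q i j v) : left x₀ v ≤ x₀ := by
  obtain ⟨⟨_, h1⟩, h2, h3, h4, h5, h6, h7⟩ := hv
  simp only [left]; split_ifs <;> omega

theorem Frame.lt_right (hv : Frame x₀ y₀ p q i j v) : x₀ < right x₀ v := by
  obtain ⟨⟨_, h1⟩, h2, h3, h4, h5, h6, h7⟩ := hv
  simp only [right]; split_ifs <;> omega

/-- A position beyond `p` or `q` uses up the only bend. -/
theorem Frame.one_bend (hv : Frame x₀ y₀ p q i j v) : p ≤ left x₀ v ∨ right x₀ v ≤ q := by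
  obtain ⟨⟨_, h1⟩, h2, h3, h4, h5, h6, h7⟩ := hv
  simp only [left, right]; split_ifs <;> omega

theorem Frame.hor_iff (hv : Frame x₀ y₀ p q i j v) (x y : ℤ) :
    v.Hor x y ↔ y = y₀ ∧ left x₀ v ≤ x ∧ p ≤ x ∧ x + 1 ≤ right x₀ v ∧ x + 1 ≤ q := by
  obtain ⟨⟨rfl, h1⟩, h2, h3, h4, h5, h6, h7⟩ := hv
  simp only [left, right, Hor]
  split_ifs with hc
  · by_cases hd : v.d = v.b
    · omega
    · have := (h6 hc hd).1; omega
  · by_cases hd : v.d = v.b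
    · omega
    · have := (h7 (by omega) hd).1; omega

theorem Frame.ver_iff (hv : Frame x₀ y₀ p q i j v) (x y : ℤ) :
    v.Ver x y ↔ (x = p ∧ (i ∧ y₀ ≤ y ∧ y + 1 ≤ y₀ + (p - left x₀ v) ∨
        ¬ i ∧ y₀ - (p - left x₀ v) ≤ y ∧ y + 1 ≤ y₀)) ∨
      (x = q ∧ (j ∧ y₀ ≤ y ∧ y + 1 ≤ y₀ + (right x₀ v - q) ∨
        ¬ j ∧ y₀ - (right x₀ v - q) ≤ y ∧ y + 1 ≤ y₀)) := by
  obtain ⟨⟨rfl, h1⟩, h2, h3, h4, h5, h6, h7⟩ := hv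
  simp only [left, right, Ver]
  split_ifs with hc
  · by_cases hd : v.d = v.b
    · omega
    · obtain ⟨e1, e2⟩ := h6 hc hd
      clear h6 h7
      by_cases hi : i <;> simp only [hi, iff_true, iff_false, true_and, false_and, not_true,
        not_false_eq_true, false_or, or_false] at e2 ⊢ <;> omega
  · by_cases hd : v.d = v.b
    · omega
    · obtain ⟨e1, e2⟩ := h7 (by omega) hd
      clear h6 h7
      by_cases hj : j <;> simp only [hj, iff_true, iff_false, true_and, false_and, not_true,
        not_false_eq_true, false_or, or_false] at e2 ⊢ <;> omega

theorem Frame.ver_left (hv : Frame x₀ y₀ p q i j v) (h : left x₀ v < p) :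
    i ∧ v.Ver p y₀ ∨ ¬ i ∧ v.Ver p (y₀ - 1) := by
  by_cases hi : i
  · exact Or.inl ⟨hi, (hv.ver_iff _ _).2 (Or.inl ⟨rfl, Or.inl ⟨hi, by omega⟩⟩)⟩
  · exact Or.inr ⟨hi, (hv.ver_iff _ _).2 (Or.inl ⟨rfl, Or.inr ⟨hi, by omega⟩⟩)⟩

theorem Frame.ver_right (hv : Frame x₀ y₀ p q i j v) (h : q < right x₀ v) :
    v.Ver q y₀ ∨ v.Ver q (y₀ - 1) := by
  by_cases hj : j
  · exact Or.inl ((hv.ver_iff _ _).2 (Or.inr ⟨rfl, Or.inl ⟨hj, by omega⟩⟩))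
  · exact Or.inr ((hv.ver_iff _ _).2 (Or.inr ⟨rfl, Or.inr ⟨hj, by omega⟩⟩))

theorem ver_corner {P : Hook} (h : P.d ≠ P.b) :
    P.b < P.d ∧ P.Ver P.c P.b ∨ P.d < P.b ∧ P.Ver P.c (P.b - 1) := by
  simp only [Ver, true_and]; omega

/-- The constraint that a hook `s` with its corner at the left end of its row puts on the position
`l` of the left end of the hooks from which it does not split. -/
def LeftFits (p : ℤ) (i : Prop) (s : Hook) (l : ℤ) : Prop :=
  (s.c < p → p ≤ l) ∧ (s.d ≠ s.b → p < s.c → s.c ≤ l) ∧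
    (s.d ≠ s.b → s.c = p → ¬ (s.b < s.d ↔ i) → p ≤ l)

/-- The first condition gives a common row edge. A split can occur only at the corner of `s`, at `p`
or at `q`: `LeftFits` excludes the first two, and at `q` the hook `v` must not turn when `s` runs
straight on. -/
theorem nonSplitting_iff_of_left
    (hv : Frame x₀ y₀ p q i j v) (hp : p ≤ x₀) (hq : x₀ < q) (hb : s.b = y₀) (hca : s.c < s.a)
    (hcx : s.c ≤ x₀) :
    s.NonSplitting v ↔
      left x₀ v < s.a ∧ LeftFits p i s (left x₀ v) ∧ (q < s.a → right x₀ v ≤ q) := by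
  have hl := hv.left_le
  have hr := hv.lt_right
  have hs : ∀ x, s.Hor x y₀ ↔ s.c ≤ x ∧ x + 1 ≤ s.a := by
    intro x; simp only [Hor]; omega
  constructor
  · rintro ⟨hm, hn⟩
    have h0 : left x₀ v < s.a ∧ p < s.a := by
      rcases hm with ⟨x, y, h1, h2⟩ | ⟨x, y, h1, h2⟩
      · rw [hv.hor_iff] at h2
        have := (hs x).1 (h2.1 ▸ h1)
        omega
      · rw [hv.ver_iff] at h2
        have := h1.1
        omega
    refine ⟨h0.1, ⟨fun h => ?_, fun h1 h2 => ?_, fun h1 h2 h3 => ?_⟩, fun h => ?_⟩ <;> by_contra! hlt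
    · refine hn p y₀ (splitsAt_of_hor (Or.inr ((hv.hor_iff _ _).2 (by omega)))
        (Or.inl ((hs _).2 (by omega))) ?_)
      have := hv.ver_left hlt
      tauto
    · refine hn s.c y₀ (splitsAt_of_hor (Or.inl ((hs _).2 (by omega)))
        (Or.inr ((hv.hor_iff _ _).2 (by omega))) ?_)
      have := ver_corner h1
      rw [hb] at this
      tauto
    · have k1 := hv.ver_left hlt
      have k2 := ver_corner h1
      have k3 : ¬ (s.b < s.d ∧ s.d < s.b) := by omega
      rw [h2] at k2
      have k4 : (s.Ver p y₀ ∨ v.Ver p y₀) ∧ (s.Ver p (y₀ - 1) ∨ v.Ver p (y₀ - 1)) := by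
        rw [hb] at *
        tauto
      exact hn p y₀ (splitsAt_of_ver k4.1 k4.2 (Or.inl (Or.inl ((hs _).2 (by omega)))))
    · refine hn q y₀ (splitsAt_of_hor (Or.inl ((hs _).2 (by omega)))
        (Or.inr ((hv.hor_iff _ _).2 (by omega))) ?_)
      have := hv.ver_right hlt
      tauto
  · rintro ⟨h1, ⟨h2, h3, h4⟩, h5⟩
    refine ⟨Or.inl ⟨min (s.a - 1) x₀, y₀, (hs _).2 (by omega), (hv.hor_iff _ _).2 (by omega)⟩,
      fun x y hxy => ?_⟩
    -- Every split involves a row edge, and both hooks have theirs on row `y₀`.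
    have e : y = y₀ := by
      have k : ∀ x, s.Hor x y ∨ v.Hor x y → y = y₀ := by
        rintro x (h | h)
        · exact h.1.trans hb
        · exact ((hv.hor_iff _ _).1 h).1
      rcases hxy.cases with ⟨h, -⟩ | ⟨-, -, h | h⟩
      exacts [k _ h, k _ h, k _ h]
    subst e
    have b1 := hv.one_bend
    have n1 : s.Ver x y ∨ v.Ver x y → (x = s.c ∧ s.b < s.d) ∨ (x = p ∧ i ∧ left x₀ v < p) ∨
        (x = q ∧ j ∧ q < right x₀ v) := by
      rw [hv.ver_iff]; simp only [Ver]; clear hxy h2 h3 h4 h5 hv hs; grind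
    have n2 : s.Ver x (y - 1) ∨ v.Ver x (y - 1) → (x = s.c ∧ s.d < s.b) ∨
        (x = p ∧ ¬ i ∧ left x₀ v < p) ∨ (x = q ∧ ¬ j ∧ q < right x₀ v) := by
      rw [hv.ver_iff]; simp only [Ver]; clear hxy h2 h3 h4 h5 hv hs; grind
    have h := hxy.cases
    simp only [hs, hv.hor_iff, true_and] at h
    rcases h with ⟨m1, m2, m3⟩ | ⟨m1, m2, m3⟩
    · have : (x = s.c ∧ s.d ≠ s.b) ∨ (x = p ∧ left x₀ v < p) ∨ (x = q ∧ q < right x₀ v) := by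
        rcases m3 with m3 | m3
        · have := n1 m3; omega
        · have := n2 m3; omega
      clear n1 n2 m3 hxy h4
      omega
    -- Column edges on both sides of a point of the row: `v` supplies at most one, so `s` turns at
    -- `p` against the arm of `v`, which the last clause of `LeftFits` forbids.
    · have m1 := n1 m1
      have m2 := n2 m2
      clear n1 n2 hxy
      by_cases hi : i <;> by_cases hj : j <;>
      simp only [hi, hj, iff_true, iff_false, true_and, false_and, not_true,
        not_false_eq_true, false_or, or_false, and_false] at m1 m2 h4 <;> omega

theorem Frame.ver_iff_of_lt (hv : Frame x₀ y₀ p q i j v) (hi : i) (h : left x₀ v < p) (x y : ℤ) :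
    v.Ver x y ↔ x = p ∧ y₀ ≤ y ∧ y + 1 ≤ y₀ + (p - left x₀ v) := by
  have := hv.one_bend
  rw [hv.ver_iff]
  simp only [hi, true_and, not_true, false_and, or_false]
  omega

theorem hor_corner {P : Hook} (h : P.a ≠ P.c) : P.Hor P.c P.b ∨ P.Hor (P.c - 1) P.b := by
  simp only [Hor, true_and]; omega

/-- Here `s` can meet `v` only along the arm at `p`. The first bracket concerns `s` alone: it must
not run below the foot of the arm, and a turn of `s` at the lower end of its column would be passed
by every `v` that meets it. The rest says that `v` reaches `s` but does not pass a turn at the upper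
end. -/
theorem nonSplitting_iff_of_vertical_up (hv : Frame x₀ y₀ p q i j v) (hi : i) (hp : p ≤ x₀)
    (hq : x₀ < q) (hc : s.c = p) (hrow : s.b = y₀ → s.a = s.c) :
    s.NonSplitting v ↔
      (s.b ≠ s.d ∧ y₀ ≤ min s.b s.d ∧ (s.b < s.d → s.a = s.c)) ∧
        left x₀ v < p - (min s.b s.d - y₀) ∧ (s.a ≠ s.c → p - (s.b - y₀) ≤ left x₀ v) := by
  have hl := hv.left_le
  have hr := hv.lt_right
  have hs : ∀ y, s.Ver p y ↔ (s.b ≤ y ∧ y + 1 ≤ s.d) ∨ (s.d ≤ y ∧ y + 1 ≤ s.b) := by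
    intro y; simp only [Ver, hc, true_and]
  constructor
  · rintro ⟨hm, hn⟩
    obtain ⟨y, h1, h2⟩ : ∃ y, s.Ver p y ∧ v.Ver p y := by
      rcases hm with ⟨x, y, h1, h2⟩ | ⟨x, y, h1, h2⟩
      · rw [hv.hor_iff] at h2
        simp only [Hor] at h1
        omega
      · obtain rfl : x = p := h1.1.trans hc
        exact ⟨y, h1, h2⟩
    have hlt : left x₀ v < p := by
      rw [hv.ver_iff] at h2
      omega
    have hvv := hv.ver_iff_of_lt hi hlt
    have h3 := (hs y).1 h1
    have h4 := (hvv p y).1 h2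
    have h5 : y₀ ≤ min s.b s.d := by
      by_contra! h5
      exact hn p y₀ (splitsAt_of_ver (Or.inr ((hvv _ _).2 (by omega))) (Or.inl ((hs _).2 (by omega)))
        (Or.inl (Or.inr ((hv.hor_iff _ _).2 (by omega)))))
    have hcor : s.a ≠ s.c → (s.Hor p s.b ∨ v.Hor p s.b) ∨ s.Hor (p - 1) s.b ∨ v.Hor (p - 1) s.b := by
      intro h
      have := hor_corner h
      rw [hc] at this
      tauto
    refine ⟨⟨by omega, h5, fun h => ?_⟩, by omega, fun h => ?_⟩ <;> by_contra! hne
    · exact hn p s.b (splitsAt_of_ver (Or.inl ((hs _).2 (by omega)))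
        (Or.inr ((hvv _ _).2 (by omega))) (hcor hne))
    · have h6 : s.d < s.b := by
        by_contra! h6
        exact hn p s.b (splitsAt_of_ver (Or.inl ((hs _).2 (by omega)))
          (Or.inr ((hvv _ _).2 (by omega))) (hcor h))
      exact hn p s.b (splitsAt_of_ver (Or.inr ((hvv _ _).2 (by omega)))
        (Or.inl ((hs _).2 (by omega))) (hcor h))
  · rintro ⟨⟨h1, h2, h3⟩, h4, h5⟩
    have hvv := hv.ver_iff_of_lt hi (by omega)
    refine ⟨Or.inr ⟨p, min s.b s.d, (hs _).2 (by omega), (hvv _ _).2 (by omega)⟩,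
      fun x y hxy => ?_⟩
    have hsh : ∀ x y, s.Hor x y ↔ y = s.b ∧ ((s.a ≤ x ∧ x + 1 ≤ p) ∨ (p ≤ x ∧ x + 1 ≤ s.a)) := by
      intro x y; rw [← hc]; rfl
    have hsv : ∀ x y, s.Ver x y ↔ x = p ∧ ((s.b ≤ y ∧ y + 1 ≤ s.d) ∨ (s.d ≤ y ∧ y + 1 ≤ s.b)) := by
      intro x y; rw [← hc]; rfl
    rcases hxy.cases with ⟨m1, m2, m3⟩ | ⟨m1, m2, m3⟩ <;>
      simp only [hvv, hv.hor_iff, hsv, hsh] at m1 m2 m3 <;> clear hvv hv hs hxy hsh hsv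
    · have : x = p := by omega
      clear m3
      omega
    · have : x = p := by omega
      subst this
      simp only [true_and] at m1 m2
      have m4 : (y = s.b ∧ s.a ≠ s.c) ∨ y = y₀ := by omega
      clear m3
      omega

end
end Hook

/-! ### The four types of neighbourhoods in the clique. -/

namespace Hook

/-- Among the hooks with the given supporting path, those which share an edge with `s` and do not
split from it are determined in one of four ways by the positions of their ends. -/
def Classified (x₀ y₀ p q : ℤ) (i j : Prop) (s : Hook) : Prop :=
  ∃ U D : Set ℤ, IsUpperSet U ∧ IsLowerSet D ∧
    ((∀ v, Frame x₀ y₀ p q i j v → (s.NonSplitting v ↔ left x₀ v ∈ U ∧ left x₀ v ∈ D)) ∨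
     (∀ v, Frame x₀ y₀ p q i j v → (s.NonSplitting v ↔ right x₀ v ∈ U ∧ right x₀ v ∈ D)) ∨
     (∀ v, Frame x₀ y₀ p q i j v → (s.NonSplitting v ↔ left x₀ v ∈ U ∧ right x₀ v ≤ q)) ∨
     (∀ v, Frame x₀ y₀ p q i j v → (s.NonSplitting v ↔ right x₀ v ∈ D ∧ p ≤ left x₀ v)))

variable {x₀ y₀ p q : ℤ} {i j : Prop} {s : Hook}

theorem Classified.of_mirrorX (h : Classified (-x₀ - 1) y₀ (-q) (-p) j i s.mirrorX) :
    Classified x₀ y₀ p q i j s := by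
  obtain ⟨U, D, hU, hD, h⟩ := h
  refine ⟨{t | -t ∈ D}, {t | -t ∈ U}, fun a b hab ha => hD (neg_le_neg hab) ha,
    fun a b hab ha => hU (neg_le_neg hab) ha, ?_⟩
  rcases h with h | h | h | h
  · refine Or.inr (Or.inl fun v hv => ?_)
    rw [← nonSplitting_mirrorX, h _ hv.mirrorX, left_mirrorX, and_comm]; rfl
  · refine Or.inl fun v hv => ?_
    rw [← nonSplitting_mirrorX, h _ hv.mirrorX, right_mirrorX, and_comm]; rfl
  · refine Or.inr (Or.inr (Or.inr fun v hv => ?_))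
    rw [← nonSplitting_mirrorX, h _ hv.mirrorX, left_mirrorX, right_mirrorX, neg_le_neg_iff]; rfl
  · refine Or.inr (Or.inr (Or.inl fun v hv => ?_))
    rw [← nonSplitting_mirrorX, h _ hv.mirrorX, left_mirrorX, right_mirrorX, neg_le_neg_iff]; rfl

theorem Classified.of_mirrorY (h : Classified x₀ (-y₀) p q (¬ i) (¬ j) s.mirrorY) :
    Classified x₀ y₀ p q i j s := by
  obtain ⟨U, D, hU, hD, h⟩ := h
  refine ⟨U, D, hU, hD, ?_⟩
  rcases h with h | h | h | h
  · refine Or.inl fun v hv => ?_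
    rw [← nonSplitting_mirrorY, h _ hv.mirrorY, left_mirrorY]
  · refine Or.inr (Or.inl fun v hv => ?_)
    rw [← nonSplitting_mirrorY, h _ hv.mirrorY, right_mirrorY]
  · refine Or.inr (Or.inr (Or.inl fun v hv => ?_))
    rw [← nonSplitting_mirrorY, h _ hv.mirrorY, left_mirrorY, right_mirrorY]
  · refine Or.inr (Or.inr (Or.inr fun v hv => ?_))
    rw [← nonSplitting_mirrorY, h _ hv.mirrorY, left_mirrorY, right_mirrorY]

theorem classified_of_not (h : ∀ v, Frame x₀ y₀ p q i j v → ¬ s.NonSplitting v) :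
    Classified x₀ y₀ p q i j s :=
  ⟨∅, ∅, isUpperSet_empty, isLowerSet_empty, Or.inl fun v hv => by simpa using h v hv⟩

theorem isUpperSet_leftFits (p : ℤ) (i : Prop) (s : Hook) : IsUpperSet {l | LeftFits p i s l} :=
  fun _ _ hab ⟨h1, h2, h3⟩ => ⟨fun h => (h1 h).trans hab, fun h h' => (h2 h h').trans hab,
    fun h h' h'' => (h3 h h' h'').trans hab⟩

theorem classified_of_left (hp : p ≤ x₀) (hq : x₀ < q) (hb : s.b = y₀) (hca : s.c < s.a)
    (hcx : s.c ≤ x₀) : Classified x₀ y₀ p q i j s := by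
  refine ⟨{l | LeftFits p i s l}, Set.Iio s.a, isUpperSet_leftFits p i s, isLowerSet_Iio _, ?_⟩
  by_cases h : q < s.a
  · refine Or.inr (Or.inr (Or.inl fun v hv => ?_))
    have := hv.left_le
    rw [nonSplitting_iff_of_left hv hp hq hb hca hcx]
    -- When `s` runs past `q`, the bound `left x₀ v < s.a` is automatic, since left ends are at most
    -- `x₀ < q`.
    exact ⟨fun e => ⟨e.2.1, e.2.2 h⟩, fun e => ⟨by omega, e.1, fun _ => e.2⟩⟩
  · refine Or.inl fun v hv => ?_
    rw [nonSplitting_iff_of_left hv hp hq hb hca hcx]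
    exact ⟨fun e => ⟨e.2.1, e.1⟩, fun e => ⟨e.2, e.1, fun e' => absurd e' h⟩⟩

theorem classified_of_right (hp : p ≤ x₀) (hq : x₀ < q) (hb : s.b = y₀) (hca : s.a < s.c)
    (hcx : x₀ < s.c) : Classified x₀ y₀ p q i j s := by
  apply Classified.of_mirrorX
  exact classified_of_left (by omega) (by omega) hb (by simp only [mirrorX]; omega)
    (by simp only [mirrorX]; omega)

theorem NonSplitting.congr_left {P P' Q : Hook} (h1 : ∀ x y, P.Hor x y ↔ P'.Hor x y)
    (h2 : ∀ x y, P.Ver x y ↔ P'.Ver x y) : P.NonSplitting Q ↔ P'.NonSplitting Q := by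
  simp only [NonSplitting, Meets, SplitsAt, h1, h2]

theorem classified_of_corner_right (hp : p ≤ x₀) (hq : x₀ < q) (hb : s.b = y₀) (hca : s.c < s.a)
    (hcx : x₀ < s.c) : Classified x₀ y₀ p q i j s := by
  by_cases hd : s.d = s.b
  -- A straight hook may take its other end as corner, which leads to the mirrored case.
  · have h1 : ∀ x y, (Hook.mk s.a s.b s.c s.b).Hor x y ↔ s.Hor x y := by
      intro x y; simp only [Hor]; omega
    have h2 : ∀ x y, (Hook.mk s.a s.b s.c s.b).Ver x y ↔ s.Ver x y := by
      intro x y; simp only [Ver]; omega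
    have h := classified_of_right (s := ⟨s.a, s.b, s.c, s.b⟩) (i := i) (j := j) hp hq hb hca
      (hcx.trans hca)
    simpa only [Classified, NonSplitting.congr_left h1 h2] using h
  · refine classified_of_not fun v hv ⟨hm, hn⟩ => ?_
    have hl := hv.left_le
    have hr := hv.lt_right
    have hc : s.Hor s.c y₀ := ⟨hb.symm, by omega⟩
    -- Coming from the edge at `x₀`, `v` runs along the row up to the corner of `s` before it can
    -- share an edge with `s`.
    have hc' : v.Hor (s.c - 1) y₀ := by
      rw [hv.hor_iff]
      rcases hm with ⟨x, y, h1, h2⟩ | ⟨x, y, h1, h2⟩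
      · rw [hv.hor_iff] at h2
        simp only [Hor] at h1
        omega
      · rw [hv.ver_iff] at h2
        simp only [Ver] at h1
        omega
    refine hn s.c y₀ (splitsAt_of_hor (Or.inl hc) (Or.inr hc') ?_)
    have := ver_corner hd
    rw [hb] at this
    tauto

theorem classified_of_corner_left (hp : p ≤ x₀) (hq : x₀ < q) (hb : s.b = y₀) (hca : s.a < s.c)
    (hcx : s.c ≤ x₀) : Classified x₀ y₀ p q i j s := by
  apply Classified.of_mirrorX
  exact classified_of_corner_right (by omega) (by omega) hb (by simp only [mirrorX]; omega)
    (by simp only [mirrorX]; omega)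

theorem classified_of_vertical_up (hp : p ≤ x₀) (hq : x₀ < q) (hi : i) (hc : s.c = p)
    (hrow : s.b = y₀ → s.a = s.c) : Classified x₀ y₀ p q i j s := by
  by_cases h : s.b ≠ s.d ∧ y₀ ≤ min s.b s.d ∧ (s.b < s.d → s.a = s.c)
  · refine ⟨{l | s.a ≠ s.c → p - (s.b - y₀) ≤ l}, Set.Iio (p - (min s.b s.d - y₀)),
      fun a b hab ha h' => (ha h').trans hab, isLowerSet_Iio _, Or.inl fun v hv => ?_⟩
    rw [nonSplitting_iff_of_vertical_up hv hi hp hq hc hrow, and_iff_right h, and_comm]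
    rfl
  · refine classified_of_not fun v hv => ?_
    rw [nonSplitting_iff_of_vertical_up hv hi hp hq hc hrow]
    exact fun e => h e.1

theorem classified_of_vertical_left (hp : p ≤ x₀) (hq : x₀ < q) (hc : s.c = p)
    (hrow : s.b = y₀ → s.a = s.c) : Classified x₀ y₀ p q i j s := by
  by_cases hi : i
  · exact classified_of_vertical_up hp hq hi hc hrow
  · apply Classified.of_mirrorY
    exact classified_of_vertical_up hp hq hi hc fun h => hrow (neg_inj.1 h)

theorem classified (hp : p ≤ x₀) (hq : x₀ < q) (s : Hook) : Classified x₀ y₀ p q i j s := by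
  by_cases hrow : s.b = y₀ → s.a = s.c
  · by_cases hc : s.c = p
    · exact classified_of_vertical_left hp hq hc hrow
    by_cases hc' : s.c = q
    · apply Classified.of_mirrorX
      refine classified_of_vertical_left (by omega) (by omega) (by simp only [mirrorX]; omega) ?_
      simpa only [mirrorX, neg_inj] using hrow
    -- The supporting path has column edges only above or below `p` and `q`, and `s` has no edge on
    -- row `y₀`.
    · refine classified_of_not fun v hv ⟨hm, _⟩ => ?_
      rcases hm with ⟨x, y, h1, h2⟩ | ⟨x, y, h1, h2⟩
      · rw [hv.hor_iff] at h2
        simp only [Hor] at h1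
        omega
      · rw [hv.ver_iff] at h2
        simp only [Ver] at h1
        omega
  · push Not at hrow
    obtain ⟨hb, hne⟩ := hrow
    rcases lt_or_gt_of_ne hne with h | h
    · by_cases hx : s.c ≤ x₀
      · exact classified_of_corner_left hp hq hb h hx
      · exact classified_of_right hp hq hb h (by omega)
    · by_cases hx : s.c ≤ x₀
      · exact classified_of_left hp hq hb h hx
      · exact classified_of_corner_right hp hq hb h (by omega)

end Hook

/-- The neighbourhoods in the clique of all other vertices, in terms of two linear orders. -/
theorem exists_orders {V : Type u} {G : SimpleGraph V} (hG : IsBendENPG 1 G) {K : Finset V}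
    (hK : G.IsClique (K : Set V)) (hK2 : K.Nontrivial) :
    ∃ (l r : V → ℤ) (p q : ℤ), ∀ s, s ∉ K → ∃ U D : Set ℤ, IsUpperSet U ∧ IsLowerSet D ∧
      ((∀ v ∈ K, G.Adj s v ↔ l v ∈ U ∧ l v ∈ D) ∨ (∀ v ∈ K, G.Adj s v ↔ r v ∈ U ∧ r v ∈ D) ∨
        (∀ v ∈ K, G.Adj s v ↔ l v ∈ U ∧ r v ≤ q) ∨ ∀ v ∈ K, G.Adj s v ↔ r v ∈ D ∧ p ≤ l v) := by
  obtain ⟨P, hP, hadj⟩ := hG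
  choose Q hQ using fun v => (P v).exists_hook (hP v)
  have hadj' : ∀ u v, G.Adj u v ↔ u ≠ v ∧ (Q u).NonSplitting (Q v) := fun u v => by
    rw [hadj, Hook.nonSplitting_iff (hQ u) (hQ v)]
  -- For `u = v` this says that the path has an edge; a second clique vertex ensures it.
  have hns : ∀ u ∈ K, ∀ v ∈ K, (Q u).NonSplitting (Q v) := by
    intro u hu v hv
    by_cases huv : u = v
    · subst huv
      obtain ⟨w, hw, hwu⟩ := hK2.exists_ne u
      obtain ⟨h | h, -⟩ := ((hadj' u w).1 (hK hu hw hwu.symm)).2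
      · obtain ⟨x, y, h1, -⟩ := h
        exact ⟨Or.inl ⟨x, y, h1, h1⟩, (Q u).not_splitsAt_self⟩
      · obtain ⟨x, y, h1, -⟩ := h
        exact ⟨Or.inr ⟨x, y, h1, h1⟩, (Q u).not_splitsAt_self⟩
    · exact ((hadj' u v).1 (hK hu hv huv)).2
  have main : ∀ R : V → Hook, (∀ u v, (R u).NonSplitting (R v) ↔ (Q u).NonSplitting (Q v)) →
      (∃ x y, ∀ v ∈ K, (R v).Hor x y) → ∃ (l r : V → ℤ) (p q : ℤ), ∀ s, s ∉ K →
      ∃ U D : Set ℤ, IsUpperSet U ∧ IsLowerSet D ∧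
      ((∀ v ∈ K, G.Adj s v ↔ l v ∈ U ∧ l v ∈ D) ∨ (∀ v ∈ K, G.Adj s v ↔ r v ∈ U ∧ r v ∈ D) ∨
        (∀ v ∈ K, G.Adj s v ↔ l v ∈ U ∧ r v ≤ q) ∨ ∀ v ∈ K, G.Adj s v ↔ r v ∈ D ∧ p ≤ l v) := by
    rintro R hR ⟨x, y, he⟩
    obtain ⟨p, q, i, j, hp, hq, hF⟩ :=
      Hook.exists_frame R (fun u hu v hv => (hR u v).2 (hns u hu v hv)) he
    refine ⟨fun v => Hook.left x (R v), fun v => Hook.right x (R v), p, q, fun s hs => ?_⟩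
    have hs' : ∀ v ∈ K, G.Adj s v ↔ (R s).NonSplitting (R v) := fun v hv => by
      rw [hadj', hR, and_iff_right]
      rintro rfl
      exact hs hv
    obtain ⟨U, D, hU, hD, h⟩ := Hook.classified (y₀ := y) (i := i) (j := j) hp hq (R s)
    refine ⟨U, D, hU, hD, ?_⟩
    rcases h with h | h | h | h
    · exact Or.inl fun v hv => (hs' v hv).trans (h _ (hF v hv))
    · exact Or.inr (Or.inl fun v hv => (hs' v hv).trans (h _ (hF v hv)))
    · exact Or.inr (Or.inr (Or.inl fun v hv => (hs' v hv).trans (h _ (hF v hv))))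
    · exact Or.inr (Or.inr (Or.inr fun v hv => (hs' v hv).trans (h _ (hF v hv))))
  rcases Hook.exists_common_edge hK2.nonempty Q hns with h | h
  · exact main Q (fun _ _ => Iff.rfl) h
  · exact main (fun v => (Q v).transpose) (fun _ _ => Hook.nonSplitting_transpose) h

/-! ### Counting chains and intervals of a fixed size. -/

section Counting

variable {V : Type u} {T K : Finset V} {N : V → Finset V} {d : ℕ}

theorem card_le_one_of_nested (hN : Set.InjOn N T) (hd : ∀ s ∈ T, (N s).card = d)
    (h : ∀ s ∈ T, ∀ t ∈ T, N s ⊆ N t ∨ N t ⊆ N s) : T.card ≤ 1 := by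
  refine Finset.card_le_one.2 fun s hs t ht => hN hs ht ?_
  rcases h s hs t ht with e | e
  · exact Finset.eq_of_subset_of_card_le e (by rw [hd s hs, hd t ht])
  · exact (Finset.eq_of_subset_of_card_le e (by rw [hd s hs, hd t ht])).symm

theorem card_le_of_injOn_start (ρ : V → ℕ) (m : ℕ) (hρ : Set.InjOn ρ T)
    (h : ∀ s ∈ T, ρ s + d ≤ m) : (T.card : ℤ) ≤ max ((m : ℤ) + 1 - d) 0 := by
  rcases T.eq_empty_or_nonempty with rfl | ⟨s, hs⟩
  · simp
  have h1 := h s hs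
  have h2 := Finset.card_le_card_of_injOn (t := Finset.range (m + 1 - d)) ρ (fun t ht => by
    have := h t ht
    simp only [Finset.coe_range, Set.mem_Iio]
    omega) hρ
  rw [Finset.card_range] at h2
  omega

open Classical in
/-- The number of intervals of size `d` in a finite set which is ordered by a function. -/
theorem card_le_of_interval (f : V → ℤ) (hN : Set.InjOn N T) (hd : ∀ s ∈ T, (N s).card = d)
    (h : ∀ s ∈ T, ∃ U D : Set ℤ, IsUpperSet U ∧ IsLowerSet D ∧
      ∀ v, v ∈ N s ↔ v ∈ K ∧ f v ∈ U ∧ f v ∈ D) :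
    (T.card : ℤ) ≤ max ((K.card : ℤ) + 1 - d) 0 := by
  choose! U D hU hD hUD using h
  -- The start of an interval is the number of elements of `K` below it. The order may have ties:
  -- nested upper sets with equal counts have the same trace on `K`, and then the nested lower sets
  -- make the neighbourhoods nested.
  refine card_le_of_injOn_start (fun s => (K.filter fun v => f v ∉ U s).card) K.card ?_ ?_
  · intro s hs t ht hst
    dsimp only at hst
    have hU' : ∀ v ∈ K, f v ∈ U s ↔ f v ∈ U t := by
      have key : ∀ s t : V, U s ⊆ U t → (K.filter fun v => f v ∉ U s).card =
          (K.filter fun v => f v ∉ U t).card → ∀ v ∈ K, f v ∈ U s ↔ f v ∈ U t := by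
        intro s t hsub hst v hv
        have hsub' : (K.filter fun v => f v ∉ U t) ⊆ K.filter fun v => f v ∉ U s :=
          Finset.monotone_filter_right K fun v _ hv e => hv (hsub e)
        have := Finset.eq_of_subset_of_card_le hsub' hst.le
        have h1 := Finset.ext_iff.1 this v
        simp only [Finset.mem_filter, hv, true_and] at h1
        exact (not_iff_not.1 h1).symm
      rcases (hU s hs).total (hU t ht) with e | e
      · exact key s t e hst
      · exact fun v hv => (key t s e hst.symm v hv).symm
    have key : ∀ s ∈ T, ∀ t ∈ T, (∀ v ∈ K, f v ∈ U s ↔ f v ∈ U t) → D s ⊆ D t → N s = N t := by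
      intro s hs t ht hU' hsub
      refine Finset.eq_of_subset_of_card_le (fun v hv => ?_) (by rw [hd s hs, hd t ht])
      obtain ⟨h1, h2, h3⟩ := (hUD s hs v).1 hv
      exact (hUD t ht v).2 ⟨h1, (hU' v h1).1 h2, hsub h3⟩
    rcases (hD s hs).total (hD t ht) with e | e
    · exact hN hs ht (key s hs t ht hU' e)
    · exact hN hs ht (key t ht s hs (fun v hv => (hU' v hv).symm) e).symm
  · intro s hs
    rw [← hd s hs, ← Finset.card_union_of_disjoint]
    · exact Finset.card_le_card (Finset.union_subset (Finset.filter_subset _ _)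
        fun v hv => ((hUD s hs v).1 hv).1)
    · exact Finset.disjoint_left.2 fun v h1 h2 =>
        (Finset.mem_filter.1 h1).2 ((hUD s hs v).1 h2).2.1

theorem card_le_of_infix [DecidableEq V] {l : List V} (hl : l.Nodup) (hN : Set.InjOn N T)
    (hd : ∀ s ∈ T, (N s).card = d) (h : ∀ s ∈ T, ∃ a : List V, a <:+: l ∧ N s = a.toFinset) :
    (T.card : ℤ) ≤ max ((l.length : ℤ) + 1 - d) 0 := by
  have h' : ∀ s ∈ T, ∃ k : ℕ, k + d ≤ l.length ∧ N s = ((l.drop k).take d).toFinset := by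
    intro s hs
    obtain ⟨a, ha, hs'⟩ := h s hs
    have hlen : a.length = d := by
      rw [← hd s hs, hs', List.toFinset_card_of_nodup (ha.sublist.nodup hl)]
    obtain ⟨b, c, rfl⟩ := ha
    refine ⟨b.length, by simp only [List.length_append]; omega, ?_⟩
    rw [hs', List.append_assoc, List.drop_left, ← hlen, List.take_left]
  choose! k hk hNk using h'
  refine card_le_of_injOn_start k l.length (fun s hs t ht hst => hN hs ht ?_) hk
  rw [hNk s hs, hNk t ht, hst]

end Counting

/-! ### Bounds on the stable set from the representation. -/

section Split

variable {V : Type u} [Fintype V] [DecidableEq V] {G : SimpleGraph V} [DecidableRel G.Adj]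
  {K S : Finset V}

omit [DecidableRel G.Adj] in
theorem IsSplit.adj_mem (h : IsSplit G K S) {s v : V} (hs : s ∈ S) (hv : G.Adj s v) : v ∈ K := by
  have hu : v ∈ K ∪ S := by rw [h.union_eq]; exact Finset.mem_univ v
  rcases Finset.mem_union.1 hu with hu | hu
  · exact hu
  · exact absurd hv (h.stable hs hu hv.ne)

theorem IsSplit.neighborFinset_eq (h : IsSplit G K S) {s : V} (hs : s ∈ S) :
    G.neighborFinset s = K.filter (G.Adj s) := by
  ext v
  simp only [SimpleGraph.mem_neighborFinset, Finset.mem_filter]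
  exact ⟨fun e => ⟨h.adj_mem hs e, e⟩, fun e => e.2⟩

theorem IsSplit.injOn (h : IsSplit G K S) (hG : FalseTwinFree G) :
    Set.InjOn (fun s => G.neighborFinset s) (S : Set V) := by
  intro s hs t ht hst
  by_contra hne
  have hst : G.neighborSet s = G.neighborSet t := by
    ext v
    simpa using Finset.ext_iff.1 hst v
  refine hG s t hne (h.stable hs ht hne) ?_
  have h1 : t ∉ G.neighborSet s := h.stable hs ht hne
  have h2 : s ∉ G.neighborSet t := h.stable ht hs (Ne.symm hne)
  rw [Set.sdiff_singleton_eq_self h1, Set.sdiff_singleton_eq_self h2, hst]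

theorem IsSplit.degree_pos (h : IsSplit G K S) {s : V} (hs : s ∈ S) : 0 < G.degree s := by
  obtain ⟨v, hv, -⟩ := h.maximal s hs
  have : Nontrivial V := ⟨s, v, fun e => Finset.disjoint_left.1 h.disjoint hv (e ▸ hs)⟩
  exact h.connected.preconnected.degree_pos_of_nontrivial s

theorem IsSplit.degree_lt (h : IsSplit G K S) {s : V} (hs : s ∈ S) : G.degree s < K.card := by
  obtain ⟨v, hv, hsv⟩ := h.maximal s hs
  rw [← SimpleGraph.card_neighborFinset_eq_degree, h.neighborFinset_eq hs]
  exact Finset.card_lt_card (Finset.filter_ssubset.2 ⟨v, hv, hsv⟩)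

theorem IsSplit.card_ofDegree_le (h : IsSplit G K S) (hG : IsBendENPG 1 G)
    (hT : FalseTwinFree G) (d : ℕ) :
    ((ofDegree G S d).card : ℤ) ≤ max (2 * ((K.card : ℤ) + 2 - d)) 0 := by
  classical
  rcases (ofDegree G S d).eq_empty_or_nonempty with e | ⟨s₀, hs₀⟩
  · rw [e]; simp
  have hdeg : ∀ s ∈ ofDegree G S d, s ∈ S ∧ G.degree s = d := fun s hs => Finset.mem_filter.1 hs
  have hd1 := h.degree_pos (hdeg s₀ hs₀).1
  have hd2 := h.degree_lt (hdeg s₀ hs₀).1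
  rw [(hdeg s₀ hs₀).2] at hd1 hd2
  -- A vertex of degree `d` forces `0 < d < |K|`, which also makes the truncations at zero harmless.
  have hK2 : K.Nontrivial := Finset.one_lt_card_iff_nontrivial.1 (by omega)
  obtain ⟨l, r, p, q, hlr⟩ := exists_orders hG h.clique hK2
  set N : V → Finset V := fun s => G.neighborFinset s with hN
  have hNK : ∀ s ∈ S, ∀ Q : V → Prop, (∀ v ∈ K, G.Adj s v ↔ Q v) →
      ∀ v, v ∈ N s ↔ v ∈ K ∧ Q v := by
    intro s hs Q hQ v
    rw [hN]; dsimp only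
    rw [h.neighborFinset_eq hs, Finset.mem_filter]
    exact and_congr_right (hQ v)
  let T (Z : V → Prop) : Finset V := (ofDegree G S d).filter Z
  have hTS : ∀ Z, T Z ⊆ S := fun Z s hs => (hdeg s (Finset.mem_filter.1 hs).1).1
  have hinj : ∀ Z, Set.InjOn N (T Z) := fun Z => (h.injOn hT).mono (hTS Z)
  have hcard : ∀ Z, ∀ s ∈ T Z, (N s).card = d := fun Z s hs =>
    (hdeg s (Finset.mem_filter.1 hs).1).2
  let Z1 (f : V → ℤ) (s : V) : Prop := ∃ U D : Set ℤ, IsUpperSet U ∧ IsLowerSet D ∧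
    ∀ v ∈ K, G.Adj s v ↔ f v ∈ U ∧ f v ∈ D
  let Z3 (s : V) : Prop := ∃ U : Set ℤ, IsUpperSet U ∧ ∀ v ∈ K, G.Adj s v ↔ l v ∈ U ∧ r v ≤ q
  let Z4 (s : V) : Prop := ∃ D : Set ℤ, IsLowerSet D ∧ ∀ v ∈ K, G.Adj s v ↔ r v ∈ D ∧ p ≤ l v
  have b1 : ∀ f, ((T (Z1 f)).card : ℤ) ≤ max ((K.card : ℤ) + 1 - d) 0 := by
    intro f
    refine card_le_of_interval f (hinj _) (hcard _) fun s hs => ?_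
    obtain ⟨U, D, hU, hD, hs'⟩ := (Finset.mem_filter.1 hs).2
    exact ⟨U, D, hU, hD, hNK s (hTS _ hs) _ hs'⟩
  -- The condition `r v ≤ q` is the same for all these vertices, so nested upper sets give nested
  -- neighbourhoods.
  have b3 : (T Z3).card ≤ 1 := by
    refine card_le_one_of_nested (hinj _) (hcard _) fun s hs t ht => ?_
    obtain ⟨U, hU, hs'⟩ := (Finset.mem_filter.1 hs).2
    obtain ⟨U', hU', ht'⟩ := (Finset.mem_filter.1 ht).2
    refine (hU.total hU').imp (fun e v => ?_) (fun e v => ?_) <;>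
      rw [hNK s (hTS _ hs) _ hs', hNK t (hTS _ ht) _ ht'] <;>
      exact fun hv => ⟨hv.1, e hv.2.1, hv.2.2⟩
  have b4 : (T Z4).card ≤ 1 := by
    refine card_le_one_of_nested (hinj _) (hcard _) fun s hs t ht => ?_
    obtain ⟨U, hU, hs'⟩ := (Finset.mem_filter.1 hs).2
    obtain ⟨U', hU', ht'⟩ := (Finset.mem_filter.1 ht).2
    refine (hU.total hU').imp (fun e v => ?_) (fun e v => ?_) <;>
      rw [hNK s (hTS _ hs) _ hs', hNK t (hTS _ ht) _ ht'] <;>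
      exact fun hv => ⟨hv.1, e hv.2.1, hv.2.2⟩
  have hsub : ofDegree G S d ⊆ (T (Z1 l) ∪ T (Z1 r)) ∪ (T Z3 ∪ T Z4) := by
    intro s hs
    obtain ⟨U, D, hU, hD, hs'⟩ := hlr s (Finset.disjoint_right.1 h.disjoint (hdeg s hs).1)
    simp only [Finset.mem_union, T, Finset.mem_filter, hs, true_and]
    rcases hs' with e | e | e | e
    · exact Or.inl (Or.inl ⟨U, D, hU, hD, e⟩)
    · exact Or.inl (Or.inr ⟨U, D, hU, hD, e⟩)
    · exact Or.inr (Or.inl ⟨U, hU, e⟩)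
    · exact Or.inr (Or.inr ⟨D, hD, e⟩)
  have c0 := Finset.card_le_card hsub
  have c1 := Finset.card_union_le (T (Z1 l) ∪ T (Z1 r)) (T Z3 ∪ T Z4)
  have c2 := Finset.card_union_le (T (Z1 l)) (T (Z1 r))
  have c3 := Finset.card_union_le (T Z3) (T Z4)
  have c4 := b1 l
  have c5 := b1 r
  omega

theorem IsSplit.card_le (h : IsSplit G K S) (hG : IsBendENPG 1 G) (hT : FalseTwinFree G) :
    S.card ≤ 6 * K.card ^ 2 := by
  rcases S.eq_empty_or_nonempty with rfl | ⟨s₀, hs₀⟩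
  · simp
  have hK : 0 < K.card := (h.degree_pos hs₀).trans (h.degree_lt hs₀)
  have hsub : S ⊆ (Finset.range K.card).biUnion fun d => ofDegree G S d := fun s hs =>
    Finset.mem_biUnion.2 ⟨G.degree s, Finset.mem_range.2 (h.degree_lt hs),
      Finset.mem_filter.2 ⟨hs, rfl⟩⟩
  -- `2(|K| + 2) ≤ 6|K|` because `K` is nonempty.
  have hb : ∀ d ∈ Finset.range K.card, (ofDegree G S d).card ≤ 6 * K.card := fun d _ => by
    have := h.card_ofDegree_le hG hT d
    omega
  refine (Finset.card_le_card hsub).trans (Finset.card_biUnion_le.trans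
    ((Finset.sum_le_card_nsmul _ _ _ hb).trans (le_of_eq ?_)))
  rw [Finset.card_range, smul_eq_mul]
  ring

/-! ### Bounds on the classes of a certificate. -/

namespace Certificate

variable (C : Certificate G K S) (X : Side) {d : ℕ}

omit [Fintype V] [DecidableRel G.Adj] in
theorem SPart_subset (Z : Kind) : C.SPart X Z ⊆ S := fun s hs => (C.SPart_cover s).2 ⟨X, Z, hs⟩

theorem injOn_ofDegree (h : IsSplit G K S) (hT : FalseTwinFree G) (Z : Kind) (d : ℕ) :
    Set.InjOn (fun s => G.neighborFinset s) (ofDegree G (C.SPart X Z) d : Set V) :=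
  (h.injOn hT).mono fun _ hs => C.SPart_subset X Z (Finset.mem_filter.1 hs).1

omit [Fintype V] [DecidableRel G.Adj] in
theorem length_perm (Y : Dir) : (C.perm X Y).length = (C.KPart X Y).card := by
  rw [← C.perm_toFinset, List.toFinset_card_of_nodup (C.perm_nodup X Y)]

omit [Fintype V] [DecidableRel G.Adj] in
theorem mem_perm (Y : Dir) {v : V} : v ∈ C.perm X Y ↔ v ∈ C.KPart X Y := by
  rw [← C.perm_toFinset, List.mem_toFinset]

theorem card_ofDegree_dir_le (h : IsSplit G K S) (hT : FalseTwinFree G) (Y : Dir) (d : ℕ) :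
    ((ofDegree G (C.SPart X (.dir Y)) d).card : ℤ) ≤ max (((C.KPart X Y).card : ℤ) + 1 - d) 0 := by
  rw [← C.length_perm]
  refine card_le_of_infix (C.perm_nodup X Y) (C.injOn_ofDegree X h hT _ d)
    (fun s hs => (Finset.mem_filter.1 hs).2) fun s hs => ?_
  obtain ⟨h1, h2⟩ := C.interval X Y s (Finset.mem_filter.1 hs).1
  refine ⟨C.arc s, h1, ?_⟩
  ext v
  simp [h2]

theorem neighborFinset_HV {s : V} (hs : s ∈ C.SPart X .HV) :
    G.neighborFinset s = (C.arc s).toFinset ∪ C.KPart X .V := by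
  ext v
  simp [(C.suffix_union X s hs).2.2 v]

theorem degree_HV {s : V} (hs : s ∈ C.SPart X .HV) :
    G.degree s = (C.arc s).length + (C.KPart X .V).card := by
  have h2 := (C.suffix_union X s hs).2.1
  rw [← SimpleGraph.card_neighborFinset_eq_degree, C.neighborFinset_HV X hs,
    Finset.card_union_of_disjoint,
    List.toFinset_card_of_nodup (h2.sublist.nodup (C.perm_nodup X .H))]
  refine Finset.disjoint_of_subset_left (fun v hv => ?_) (C.KPart_disjoint X)
  exact (C.mem_perm X .H).1 (h2.subset (List.mem_toFinset.1 hv))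

theorem card_ofDegree_HV_le (h : IsSplit G K S) (hT : FalseTwinFree G) (d : ℕ) :
    (ofDegree G (C.SPart X .HV) d).card ≤ if (C.KPart X .V).card < d then 1 else 0 := by
  have hdeg : ∀ s ∈ ofDegree G (C.SPart X .HV) d,
      s ∈ C.SPart X .HV ∧ G.degree s = d := fun s hs => Finset.mem_filter.1 hs
  split_ifs with hd
  · refine card_le_one_of_nested (C.injOn_ofDegree X h hT _ d) (fun s hs => (hdeg s hs).2)
      fun s hs t ht => ?_
    rw [C.neighborFinset_HV X (hdeg s hs).1, C.neighborFinset_HV X (hdeg t ht).1]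
    have h1 := (C.suffix_union X s (hdeg s hs).1).2.1
    have h2 := (C.suffix_union X t (hdeg t ht).1).2.1
    refine (List.suffix_or_suffix_of_suffix h1 h2).imp (fun e => ?_) (fun e => ?_) <;>
      exact Finset.union_subset_union_left fun v hv =>
        List.mem_toFinset.2 (e.subset (List.mem_toFinset.1 hv))
  · rw [Nat.le_zero, Finset.card_eq_zero, Finset.eq_empty_iff_forall_notMem]
    intro s hs
    have h1 := C.degree_HV X (hdeg s hs).1
    -- The suffix is nonempty and disjoint from `K_{X,V}`, so the degree exceeds `|K_{X,V}|`.
    have h2 := List.length_pos_of_ne_nil (C.suffix_union X s (hdeg s hs).1).1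
    rw [(hdeg s hs).2] at h1
    omega

/-- The two classes never share a degree: intervals of `σ_{X,V}` have size at most `|K_{X,V}|`,
whereas degrees in `S_{X,HV}` are larger. -/
theorem card_ofDegree_vertical_le (h : IsSplit G K S) (hT : FalseTwinFree G) (d : ℕ) :
    ((ofDegree G (C.SPart X (.dir .V)) d ∪ ofDegree G (C.SPart X .HV) d).card : ℤ) ≤
      if (C.KPart X .V).card < d then 1 else ((C.KPart X .V).card : ℤ) + 1 - d := by
  have h1 := C.card_ofDegree_dir_le X h hT .V d
  have h2 := C.card_ofDegree_HV_le X h hT d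
  have h3 := Finset.card_union_le (ofDegree G (C.SPart X (.dir .V)) d)
    (ofDegree G (C.SPart X .HV) d)
  split_ifs at h2 ⊢ <;> omega

theorem neighborFinset_HH {s : V} (hs : s ∈ C.SPart X .HH) :
    G.neighborFinset s = (C.arc s).toFinset ∩ C.KPart X.bar .H := by
  ext v
  simp [(C.prefix_inter X s hs).2 v]

theorem card_ofDegree_HH_le (h : IsSplit G K S) (hT : FalseTwinFree G) (d : ℕ) :
    (ofDegree G (C.SPart X .HH) d).card ≤
      if d ≤ (C.KPart .L .H ∩ C.KPart .R .H).card then 1 else 0 := by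
  have hdeg : ∀ s ∈ ofDegree G (C.SPart X .HH) d,
      s ∈ C.SPart X .HH ∧ G.degree s = d := fun s hs => Finset.mem_filter.1 hs
  split_ifs with hd
  · refine card_le_one_of_nested (C.injOn_ofDegree X h hT _ d) (fun s hs => (hdeg s hs).2)
      fun s hs t ht => ?_
    rw [C.neighborFinset_HH X (hdeg s hs).1, C.neighborFinset_HH X (hdeg t ht).1]
    have h1 := (C.prefix_inter X s (hdeg s hs).1).1
    have h2 := (C.prefix_inter X t (hdeg t ht).1).1
    refine (List.prefix_or_prefix_of_prefix h1 h2).imp (fun e => ?_) (fun e => ?_) <;>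
      exact Finset.inter_subset_inter_right fun v hv =>
        List.mem_toFinset.2 (e.subset (List.mem_toFinset.1 hv))
  · rw [Nat.le_zero, Finset.card_eq_zero, Finset.eq_empty_iff_forall_notMem]
    intro s hs
    refine hd ?_
    rw [← (hdeg s hs).2, ← SimpleGraph.card_neighborFinset_eq_degree,
      C.neighborFinset_HH X (hdeg s hs).1]
    have h1 : (C.arc s).toFinset ⊆ C.KPart X .H := fun v hv =>
      (C.mem_perm X .H).1 ((C.prefix_inter X s (hdeg s hs).1).1.subset (List.mem_toFinset.1 hv))
    refine Finset.card_le_card ((Finset.inter_subset_inter_right h1).trans ?_)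
    cases X
    · exact subset_rfl
    · rw [Finset.inter_comm]; exact subset_rfl

end Certificate

end Split

end BendENPG

open BendENPG in
theorem mainTheorem10 :
    (∀ (V : Type u) [Fintype V] [DecidableEq V] (G : SimpleGraph V) [DecidableRel G.Adj]
        (K S : Finset V),
      IsSplit G K S → IsBendENPG 1 G → TwinFree G → FalseTwinFree G →
        (∀ (C : Certificate G K S) (X : Side) (d : ℕ),
          (∀ Y : Dir, ((ofDegree G (C.SPart X (.dir Y)) d).card : ℤ) ≤
            max (((C.KPart X Y).card : ℤ) + 1 - d) 0) ∧
          (ofDegree G (C.SPart X .HV) d).card ≤ (if (C.KPart X .V).card < d then 1 else 0) ∧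
          ((ofDegree G (C.SPart X (.dir .V)) d ∪ ofDegree G (C.SPart X .HV) d).card : ℤ) ≤
            (if (C.KPart X .V).card < d then 1 else ((C.KPart X .V).card : ℤ) + 1 - d) ∧
          (ofDegree G (C.SPart X .HH) d).card ≤
            (if d ≤ (C.KPart .L .H ∩ C.KPart .R .H).card then 1 else 0) ∧
          (ofDegree G (C.SPart X .HH) d).card ≤ 1) ∧
        (∀ d : ℕ, ((ofDegree G S d).card : ℤ) ≤ max (2 * ((K.card : ℤ) + 2 - d)) 0)) ∧
    (∃ c : ℕ, ∀ (V : Type u) [Fintype V] [DecidableEq V] (G : SimpleGraph V) (K S : Finset V),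
      IsSplit G K S → IsBendENPG 1 G → FalseTwinFree G → S.card ≤ c * K.card ^ 2) := by
  refine ⟨fun V _ _ G _ K S h hG _ hT => ⟨fun C X d => ⟨fun Y => C.card_ofDegree_dir_le X h hT Y d,
    C.card_ofDegree_HV_le X h hT d, C.card_ofDegree_vertical_le X h hT d,
    C.card_ofDegree_HH_le X h hT d, ?_⟩, fun d => h.card_ofDegree_le hG hT d⟩, 6, ?_⟩
  · refine (C.card_ofDegree_HH_le X h hT d).trans ?_
    split_ifs <;> omega
  · intro V _ _ G K S h hG hT
    classical
    exact h.card_le hG hT
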